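/- Let $1\le n\le d$ be integers, let $A:\mathbb{R}^d\to\mathbb{R}^d$ and $B:\mathbb{R}^n\to\mathbb{R}^d$ be linear maps, and let $F:\mathbb{R}^d\to\mathbb{R}^d$ be smooth and globally Lipschitz. Let $d_*$ be an integer with $1\le d_*\le d$ (for instance, if the vectors $A^kBe_i$, $k\ge 0$, $1\le i\le n$, span $\mathbb{R}^d$, any such $d_*$ for which those with $k\le d_*-1$ already span). Assume: (D) every complex eigenvalue of $A$ has strictly negative real part; (G) there is $a\in[0,\tfrac{1}{2d_*})$ with $\sup_{x\in\mathbb{R}^d}|F(x)|/(1+|x|)^a<\infty$. Then for every $x\in\mathbb{R}^d$ the integral $V(x)=\int_0^\infty|e^{sA}x|^2\,\mathrm{d}s$ converges, and there is a positive definite matrix $M$ with $V(x)=\langle x,Mx\rangle$ for all $x$. Moreover, there exist constants $K>0$ and $\gamma\in(0,1)$ with the following property. Let $(W_t)_{t\ge0}$ be any Wiener process in $\mathbb{R}^n$ on a probability space, let $x\in\mathbb{R}^d$, and let $(X_t)_{t\ge0}$ be a continuous process satisfying almost surely $$X_t=x+\int_0^t\bigl(AX_s+F(X_s)\bigr)\,\mathrm{d}s+BW_t\qquad\text{for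 all } t\ge0 .$$ Let $P^F_t(x,\cdot)$ denote the law of $X_t$. Then for all $t\ge0$ the function $V$ is $P^F_t(x,\cdot)$-integrable and $$\Bigl|\int_{\mathbb{R}^d}V(y)\,P^F_t(x,\mathrm{d}y)\Bigr|\le\gamma^tV(x)+K .$$ -/

import Mathlib

open MeasureTheory ProbabilityTheory
open scoped NNReal

noncomputable section

/-- Condition (D): every eigenvalue of `A`, acting on the complexification of `ℝ^d`, has strictly
negative real part. -/
def Dissipative {d : ℕ} (A : EuclideanSpace ℝ (Fin d) →L[ℝ] EuclideanSpace ℝ (Fin d)) : Prop :=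
  ∀ z : ℂ, Module.End.HasEigenvalue
    (LinearMap.baseChange ℂ (A : EuclideanSpace ℝ (Fin d) →ₗ[ℝ] EuclideanSpace ℝ (Fin d))) z →
    z.re < 0

/-- Condition (G): for some `a ∈ [0, 1/(2 d_*))`, the function `|F(x)| / (1 + |x|)^a` is bounded
on `ℝ^d`. -/
def GrowthCondition {d : ℕ} (dstar : ℕ)
    (F : EuclideanSpace ℝ (Fin d) → EuclideanSpace ℝ (Fin d)) : Prop :=
  ∃ a : ℝ, 0 ≤ a ∧ a < 1 / (2 * (dstar : ℝ)) ∧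
    BddAbove (Set.range fun x : EuclideanSpace ℝ (Fin d) => ‖F x‖ / (1 + ‖x‖) ^ a)

/-- `V(x) = ∫_0^∞ |e^{sA} x|^2 ds`. -/
def lyapunovV {d : ℕ} (A : EuclideanSpace ℝ (Fin d) →L[ℝ] EuclideanSpace ℝ (Fin d))
    (x : EuclideanSpace ℝ (Fin d)) : ℝ :=
  ∫ s in Set.Ioi (0 : ℝ), ‖(NormedSpace.exp (s • A)) x‖ ^ 2

/-- Standard Wiener process in `ℝ^n`: it starts at `0`, has independent increments, the increment
over `[s, t]` has law `N(0, (t - s) I)`, and the paths are continuous (almost surely). -/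
structure IsWienerProcess {n : ℕ} {Ω : Type*} [MeasurableSpace Ω]
    (W : ℝ≥0 → Ω → EuclideanSpace ℝ (Fin n)) (P : Measure Ω) : Prop where
  zero : ∀ᵐ ω ∂P, W 0 ω = 0
  indep : HasIndepIncrements W P
  law : ∀ s t : ℝ≥0, s ≤ t →
    HasLaw (W t - W s)
      (multivariateGaussian 0 (((t : ℝ) - s) • (1 : Matrix (Fin n) (Fin n) ℝ))) P
  cont : ∀ᵐ ω ∂P, Continuous fun t => W t ω

/-- `X` is a continuous process which solves
`X_t = x + ∫_0^t (A X_s + F(X_s)) ds + B W_t` for all `t ≥ 0`, almost surely. -/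
structure IsSDESolution {d n : ℕ} {Ω : Type*} [MeasurableSpace Ω]
    (A : EuclideanSpace ℝ (Fin d) →L[ℝ] EuclideanSpace ℝ (Fin d))
    (F : EuclideanSpace ℝ (Fin d) → EuclideanSpace ℝ (Fin d))
    (B : EuclideanSpace ℝ (Fin n) →L[ℝ] EuclideanSpace ℝ (Fin d))
    (P : Measure Ω) (W : ℝ≥0 → Ω → EuclideanSpace ℝ (Fin n))
    (x : EuclideanSpace ℝ (Fin d)) (X : ℝ≥0 → Ω → EuclideanSpace ℝ (Fin d)) : Prop where
  aemeasurable : ∀ t, AEMeasurable (X t) P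
  cont : ∀ᵐ ω ∂P, Continuous fun t => X t ω
  eqn : ∀ᵐ ω ∂P, ∀ t : ℝ≥0,
    X t ω = x + (∫ s in (0 : ℝ)..t, (A (X s.toNNReal ω) + F (X s.toNNReal ω))) + B (W t ω)

end

/-! The noise is additive, so the equation can be treated path by path, without Itô calculus.
Condition (D) makes `e^{tA}` decay exponentially, so the Gramian `T = lyapunovOp A` exists, `V(x) =
⟨x, T x⟩`, and `2⟨A x, T x⟩ = -|x|²` (`two_mul_inner_lyapunovOp`). Write `X = z + y`, where `z` is
the Ornstein-Uhlenbeck path driven by `B W` and started at `0`; then `y' = A y + F(X)` with `y_0 =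
x`. Condition (G) makes `|F(u)|² ≤ K + ε|u|²` available for every `ε > 0`. Since `E|z_t|²` is
bounded in time (`exists_ouPath_second_moment_le`), the Lyapunov equation gives `E V(y_t) ≤ e^{-ct}
V(x) + K₁`.

The delicate point is the factor of `V(x)`: it must be `γ^t`, which tends to `1` as `t → 0`. Young's
inequality applied to all of `2⟨y, T z⟩` would cost a fixed `δ V(y)` and spoil this. Instead `y_t =
e^{tA} x + r_t`. The product of the deterministic part with `z_t` has mean zero, and Young is
applied only to `⟨r, T z⟩`. As `r` starts at `0`, `E V(r_t)` is at most a constant plus `C₃ t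
e^{-ct} V(x)`, and `e^{-ct}(1 + δ C₃ t) ≤ e^{-ct/2}` for small `δ`. This is assembled in
`exists_integral_lyapunov_le`. -/

/-! ### Exponential decay of the semigroup from the spectrum of its generator. -/

theorem ContinuousLinearMap.exp_apply_of_apply_eq_smul {E : Type*} [NormedAddCommGroup E]
    [NormedSpace ℂ E] [CompleteSpace E] (a : E →L[ℂ] E) {μ : ℂ} {v : E} (hv : a v = μ • v) :
    NormedSpace.exp a v = Complex.exp μ • v := by
  have hpow : ∀ n : ℕ, (a ^ n) v = μ ^ n • v := by
    intro n
    induction n with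
    | zero => simp
    | succ n ih => rw [pow_succ, mul_apply_eq_comp, hv, map_smul, ih, smul_smul,
        pow_succ']
  have h1 : HasSum (fun n : ℕ => ((n.factorial : ℂ)⁻¹ • a ^ n) v) (NormedSpace.exp a v) :=
    (NormedSpace.exp_series_hasSum_exp' (𝕂 := ℂ) a).mapL (ContinuousLinearMap.apply ℂ E v)
  have h2 : HasSum (fun n : ℕ => ((n.factorial : ℂ)⁻¹ • μ ^ n) • v) (Complex.exp μ • v) := by
    rw [Complex.exp_eq_exp_ℂ]
    exact (NormedSpace.exp_series_hasSum_exp' (𝕂 := ℂ) μ).smul_const v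
  refine h1.unique (h2.congr_fun ?_)
  intro n
  simp [hpow, smul_smul]

/-- An eigenspace of `exp a` is invariant under `a`, hence contains an eigenvector of `a`. So every
eigenvalue of `exp a` is `exp μ` with `μ` an eigenvalue of `a`, and `|exp μ| = exp (Re μ)`. -/
theorem ContinuousLinearMap.spectralRadius_exp_lt_one {E : Type*} [NormedAddCommGroup E]
    [NormedSpace ℂ E] [FiniteDimensional ℂ E] [Nontrivial E] (a : E →L[ℂ] E)
    (ha : ∀ z : ℂ, Module.End.HasEigenvalue (a : E →ₗ[ℂ] E) z → z.re < 0) :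
    spectralRadius ℂ (NormedSpace.exp a) < 1 := by
  have : CompleteSpace E := FiniteDimensional.complete ℂ E
  refine spectrum.spectralRadius_lt_of_forall_lt _ (r := 1) ?_
  intro z hz
  have hz' : z ∈ spectrum ℂ ((NormedSpace.exp a : E →L[ℂ] E) : E →ₗ[ℂ] E) := by
    rw [← AlgEquiv.spectrum_eq (Module.End.toContinuousLinearMap (𝕜 := ℂ) E)]
    exact hz
  rw [← Module.End.hasEigenvalue_iff_mem_spectrum] at hz'
  set g : Module.End ℂ E := ((NormedSpace.exp a : E →L[ℂ] E) : E →ₗ[ℂ] E) with hg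
  have hcomm : Commute g (a : E →ₗ[ℂ] E) := by
    have h := (Commute.refl a).exp_left
    ext v
    exact congrArg (fun f : E →L[ℂ] E => f v) h.eq
  have hmaps : ∀ v ∈ g.eigenspace z, (a : E →ₗ[ℂ] E) v ∈ g.eigenspace z := by
    intro v hv
    rw [Module.End.mem_eigenspace_iff] at hv ⊢
    have := congrArg (fun f : Module.End ℂ E => f v) hcomm.eq
    simp only [Module.End.mul_apply] at this
    rw [this, hv, map_smul]
  have : Nontrivial (g.eigenspace z) := Submodule.nontrivial_iff_ne_bot.2 hz'
  obtain ⟨μ, hμ⟩ := Module.End.exists_eigenvalue ((a : E →ₗ[ℂ] E).restrict hmaps)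
  obtain ⟨v, hv⟩ := hμ.exists_hasEigenvector
  have hv0 : (v : E) ≠ 0 := fun h => hv.2 (Subtype.ext h)
  have hav : a v = μ • (v : E) := congrArg Subtype.val hv.apply_eq_smul
  have hμre : μ.re < 0 := ha μ (Module.End.hasEigenvalue_of_hasEigenvector (x := (v : E))
    ⟨Module.End.mem_eigenspace_iff.2 hav, hv0⟩)
  have h1 := a.exp_apply_of_apply_eq_smul hav
  have h2 : NormedSpace.exp a (v : E) = z • (v : E) := Module.End.mem_eigenspace_iff.1 v.2
  have hze : z = Complex.exp μ := smul_left_injective ℂ hv0 (h2.symm.trans h1)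
  rw [← NNReal.coe_lt_coe, coe_nnnorm, hze, Complex.norm_exp]
  simpa using hμre

-- Gelfand's formula: for `r` strictly between the spectral radius and `1`, eventually `‖a ^ n‖ ≤ r
-- ^ n`.
open Filter Topology in
theorem tendsto_pow_zero_of_spectralRadius_lt_one {R : Type*} [NormedRing R] [NormedAlgebra ℂ R]
    [CompleteSpace R] {a : R} (ha : spectralRadius ℂ a < 1) :
    Tendsto (fun n : ℕ => a ^ n) atTop (𝓝 0) := by
  obtain ⟨r, har, hr1⟩ := ENNReal.lt_iff_exists_nnreal_btwn.1 ha
  have h := spectrum.pow_nnnorm_pow_one_div_tendsto_nhds_spectralRadius a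
  have hr1' : r < 1 := by exact_mod_cast hr1
  have hev : ∀ᶠ n : ℕ in atTop, ‖a ^ n‖ ≤ (r : ℝ) ^ n := by
    filter_upwards [h.eventually_lt_const har, eventually_gt_atTop 0] with n hn hn0
    have hn1 : (n : ℝ) ≠ 0 := by exact_mod_cast hn0.ne'
    have := ENNReal.rpow_le_rpow hn.le (Nat.cast_nonneg (α := ℝ) n)
    rw [← ENNReal.rpow_mul, one_div, inv_mul_cancel₀ hn1, ENNReal.rpow_one,
      ENNReal.rpow_natCast] at this
    exact_mod_cast this
  exact squeeze_zero_norm' hev (tendsto_pow_atTop_nhds_zero_of_lt_one r.2 (by exact_mod_cast hr1'))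

/-- The complexification of operators on `ℝ^d`, through their matrices in the standard basis. -/
noncomputable def complexifyCLM (d : ℕ) :
    (EuclideanSpace ℝ (Fin d) →L[ℝ] EuclideanSpace ℝ (Fin d)) →ₐ[ℝ]
      (EuclideanSpace ℂ (Fin d) →L[ℂ] EuclideanSpace ℂ (Fin d)) :=
  (((Matrix.toEuclideanCLM (n := Fin d) (𝕜 := ℂ)).toAlgEquiv.toAlgHom.restrictScalars ℝ).comp
    (Complex.ofRealAm.mapMatrix)).comp
      ((Matrix.toEuclideanCLM (n := Fin d) (𝕜 := ℝ)).symm.toAlgEquiv.toAlgHom)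

theorem complexifyCLM_injective (d : ℕ) : Function.Injective (complexifyCLM d) := by
  intro a b h
  have h1 := (Matrix.toEuclideanCLM (n := Fin d) (𝕜 := ℂ)).injective h
  have h2 := Matrix.map_injective Complex.ofReal_injective h1
  exact (Matrix.toEuclideanCLM (n := Fin d) (𝕜 := ℝ)).symm.injective h2

/-- Links this normed complexification to the base change in `Dissipative`: equal characteristic
polynomials give equal eigenvalues. -/
theorem complexifyCLM_charpoly {d : ℕ}
    (A : EuclideanSpace ℝ (Fin d) →L[ℝ] EuclideanSpace ℝ (Fin d)) :
    LinearMap.charpoly (complexifyCLM d A : EuclideanSpace ℂ (Fin d) →ₗ[ℂ] _) =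
      (LinearMap.charpoly (A : EuclideanSpace ℝ (Fin d) →ₗ[ℝ] _)).map (algebraMap ℝ ℂ) := by
  set Q := (Matrix.toEuclideanCLM (n := Fin d) (𝕜 := ℝ)).symm A with hQ
  have hA : A = Matrix.toEuclideanCLM (n := Fin d) (𝕜 := ℝ) Q := by simp [hQ]
  have h1 : (A : EuclideanSpace ℝ (Fin d) →ₗ[ℝ] EuclideanSpace ℝ (Fin d)) =
      Matrix.toLin (EuclideanSpace.basisFun (Fin d) ℝ).toBasis
        (EuclideanSpace.basisFun (Fin d) ℝ).toBasis Q := by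
    rw [hA, Matrix.coe_toEuclideanCLM_eq_toEuclideanLin, Matrix.toEuclideanLin_eq_toLin_orthonormal]
  have h2 : (complexifyCLM d A : EuclideanSpace ℂ (Fin d) →ₗ[ℂ] EuclideanSpace ℂ (Fin d)) =
      Matrix.toLin (EuclideanSpace.basisFun (Fin d) ℂ).toBasis
        (EuclideanSpace.basisFun (Fin d) ℂ).toBasis (Q.map (algebraMap ℝ ℂ)) := by
    rw [← Matrix.toEuclideanLin_eq_toLin_orthonormal, ← Matrix.coe_toEuclideanCLM_eq_toEuclideanLin]
    rfl
  rw [h1, h2, Matrix.charpoly_toLin, Matrix.charpoly_toLin, Matrix.charpoly_map]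

theorem Dissipative.hasEigenvalue_complexifyCLM {d : ℕ}
    {A : EuclideanSpace ℝ (Fin d) →L[ℝ] EuclideanSpace ℝ (Fin d)} (hD : Dissipative A) (z : ℂ)
    (hz : Module.End.HasEigenvalue
      (complexifyCLM d A : EuclideanSpace ℂ (Fin d) →ₗ[ℂ] EuclideanSpace ℂ (Fin d)) z) :
    z.re < 0 := by
  refine hD z ?_
  rw [Module.End.hasEigenvalue_iff_isRoot_charpoly] at hz ⊢
  rwa [LinearMap.charpoly_baseChange, ← complexifyCLM_charpoly]

open Filter Topology in
theorem Dissipative.tendsto_exp_pow {d : ℕ} (hd : 1 ≤ d)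
    {A : EuclideanSpace ℝ (Fin d) →L[ℝ] EuclideanSpace ℝ (Fin d)} (hD : Dissipative A) :
    Tendsto (fun n : ℕ => (NormedSpace.exp A) ^ n) atTop (𝓝 0) := by
  have : Nonempty (Fin d) := ⟨⟨0, hd⟩⟩
  have hcont : Continuous (complexifyCLM d) :=
    LinearMap.continuous_of_finiteDimensional (complexifyCLM d).toLinearMap
  have h := tendsto_pow_zero_of_spectralRadius_lt_one
    ((complexifyCLM d A).spectralRadius_exp_lt_one hD.hasEigenvalue_complexifyCLM)
  -- An injective linear map in finite dimension is bounded below, so convergence of the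
  -- complexified powers descends to the real ones.
  obtain ⟨K, -, hK⟩ := LinearMap.exists_antilipschitzWith (complexifyCLM d).toLinearMap
    (LinearMap.ker_eq_bot.2 (complexifyCLM_injective d))
  have hexp : ∀ n : ℕ, NormedSpace.exp (complexifyCLM d A) ^ n =
      (complexifyCLM d).toLinearMap (NormedSpace.exp A ^ n) := by
    intro n
    let := NormedAlgebra.restrictScalars ℚ ℝ
      (EuclideanSpace ℝ (Fin d) →L[ℝ] EuclideanSpace ℝ (Fin d))
    let := NormedAlgebra.restrictScalars ℚ ℂ
      (EuclideanSpace ℂ (Fin d) →L[ℂ] EuclideanSpace ℂ (Fin d))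
    rw [← NormedSpace.map_exp (complexifyCLM d) hcont]
    exact (map_pow (complexifyCLM d) _ n).symm
  simp_rw [hexp] at h
  have hb : ∀ n : ℕ, ‖NormedSpace.exp A ^ n‖ ≤
      K * ‖(complexifyCLM d).toLinearMap (NormedSpace.exp A ^ n)‖ := by
    intro n
    simpa using hK.le_mul_dist (NormedSpace.exp A ^ n) 0
  refine squeeze_zero_norm hb ?_
  simpa using (h.norm.const_mul (K : ℝ))

theorem NormedSpace.exp_add_smul {R : Type*} [NormedRing R] [NormedAlgebra ℝ R] [CompleteSpace R]
    (a : R) (s t : ℝ) : exp ((s + t) • a) = exp (s • a) * exp (t • a) := by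
  let := NormedAlgebra.restrictScalars ℚ ℝ R
  rw [add_smul, exp_add_of_commute (((Commute.refl a).smul_left s).smul_right t)]

theorem NormedSpace.continuous_exp_smul {R : Type*} [NormedRing R] [NormedAlgebra ℝ R]
    [CompleteSpace R] (a : R) : Continuous fun t : ℝ => exp (t • a) :=
  continuous_iff_continuousAt.2 fun t => (hasDerivAt_exp_smul_const a t).continuousAt

/-- If the powers of `exp a` tend to zero, then the semigroup `exp (t • a)` decays
exponentially. -/
theorem NormedSpace.exists_norm_exp_smul_le {R : Type*} [NormedRing R] [NormedAlgebra ℝ R]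
    [CompleteSpace R] {a : R}
    (ha : Filter.Tendsto (fun n : ℕ => exp a ^ n) Filter.atTop (nhds 0)) :
    ∃ C c : ℝ, 0 ≤ C ∧ 0 < c ∧ ∀ t : ℝ, 0 ≤ t → ‖exp (t • a)‖ ≤ C * Real.exp (-(c * t)) := by
  let := NormedAlgebra.restrictScalars ℚ ℝ R
  have hev := ha.norm.eventually_lt_const
    (show ‖(0 : R)‖ < Real.exp (-1) by rw [norm_zero]; exact Real.exp_pos _)
  obtain ⟨N, hN, hN0⟩ := (hev.and (Filter.eventually_gt_atTop 0)).exists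
  have hN' : (0 : ℝ) < N := by exact_mod_cast hN0
  have hpow : ∀ k : ℕ, exp (((k : ℝ) * N) • a) = (exp a ^ N) ^ k := by
    intro k
    rw [← pow_mul, ← exp_nsmul, ← Nat.cast_smul_eq_nsmul ℝ]
    push_cast
    rw [mul_comm]
  obtain ⟨C, hC⟩ := (isCompact_Icc (a := (0 : ℝ)) (b := N)).exists_bound_of_continuousOn
    (continuous_exp_smul a).continuousOn
  have hC0 : 0 ≤ C := (norm_nonneg _).trans (hC 0 ⟨le_rfl, hN'.le⟩)
  -- Each block of length `N` contracts by `e⁻¹`, whence the rate `1 / N`. The factor `e` pays for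
  -- rounding `t / N` down, and `‖1‖ + 1` covers `k = 0`, since `‖1‖ = 1` is not assumed.
  refine ⟨(‖(1 : R)‖ + 1) * C * Real.exp 1, 1 / N, by positivity, by positivity, ?_⟩
  intro t ht
  set k := ⌊t / N⌋₊ with hk
  have hk1 : (k : ℝ) * N ≤ t := by
    have := Nat.floor_le (div_nonneg ht hN'.le)
    rwa [le_div_iff₀ hN'] at this
  have hk2 : t / N < k + 1 := Nat.lt_floor_add_one _
  have hk3 : t < (k + 1) * N := by rwa [div_lt_iff₀ hN'] at hk2
  have hsplit : t = (k : ℝ) * N + (t - k * N) := by ring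
  have hk4 : ‖(exp a ^ N) ^ k‖ ≤ (‖(1 : R)‖ + 1) * Real.exp (-(k : ℝ)) := by
    rcases Nat.eq_zero_or_pos k with h0 | h0
    · rw [h0]
      simp
    · refine (norm_pow_le' _ h0).trans ((pow_le_pow_left₀ (norm_nonneg _) hN.le k).trans ?_)
      rw [← Real.exp_nat_mul, mul_neg_one]
      exact le_mul_of_one_le_left (Real.exp_pos _).le (by linarith [norm_nonneg (1 : R)])
  have hrem := hC (t - k * N) ⟨by linarith, by nlinarith⟩
  calc ‖exp (t • a)‖
      = ‖(exp a ^ N) ^ k * exp ((t - k * N) • a)‖ := by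
        rw [← hpow, ← exp_add_smul, ← hsplit]
    _ ≤ (‖(1 : R)‖ + 1) * Real.exp (-(k : ℝ)) * C := (norm_mul_le _ _).trans
        (mul_le_mul hk4 hrem (norm_nonneg _) (by positivity))
    _ ≤ (‖(1 : R)‖ + 1) * Real.exp (1 + -(1 / N * t)) * C := by
        gcongr
        have : 1 / (N : ℝ) * t = t / N := by ring
        linarith
    _ = (‖(1 : R)‖ + 1) * C * Real.exp 1 * Real.exp (-(1 / N * t)) := by rw [Real.exp_add]; ring

/-- The semigroup generated by a dissipative matrix decays exponentially. -/
theorem Dissipative.exists_norm_exp_le {d : ℕ} (hd : 1 ≤ d)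
    {A : EuclideanSpace ℝ (Fin d) →L[ℝ] EuclideanSpace ℝ (Fin d)} (hD : Dissipative A) :
    ∃ C c : ℝ, 0 ≤ C ∧ 0 < c ∧ ∀ t : ℝ, 0 ≤ t →
      ‖NormedSpace.exp (t • A)‖ ≤ C * Real.exp (-(c * t)) :=
  NormedSpace.exists_norm_exp_smul_le (hD.tendsto_exp_pow hd)

/-! ### The Gramian, the Lyapunov equation and coercivity. -/

section LyapunovOperator

variable {E : Type*} [NormedAddCommGroup E] [InnerProductSpace ℝ E]

/-- The semigroup `e^{tA}` decays exponentially. -/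
def ExpStable (A : E →L[ℝ] E) : Prop :=
  ∃ C c : ℝ, 0 ≤ C ∧ 0 < c ∧ ∀ t : ℝ, 0 ≤ t →
    ‖NormedSpace.exp (t • A)‖ ≤ C * Real.exp (-(c * t))

theorem exp_smul_commute_apply (A : E →L[ℝ] E) (t : ℝ) (x : E) :
    NormedSpace.exp (t • A) (A x) = A (NormedSpace.exp (t • A) x) := by
  have h : Commute (NormedSpace.exp (t • A)) A := ((Commute.refl A).smul_left t).exp_left
  exact congrArg (fun f : E →L[ℝ] E => f x) h.eq

open Filter Topology in
theorem ExpStable.tendsto_exp_smul_apply {A : E →L[ℝ] E} (hA : ExpStable A) (x : E) :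
    Tendsto (fun t : ℝ => NormedSpace.exp (t • A) x) atTop (𝓝 0) := by
  obtain ⟨C, c, hC, hc, h⟩ := hA
  have hb : ∀ᶠ t : ℝ in atTop, ‖NormedSpace.exp (t • A) x‖ ≤ C * Real.exp (-(c * t)) * ‖x‖ := by
    filter_upwards [eventually_ge_atTop 0] with t ht
    exact (ContinuousLinearMap.le_opNorm _ _).trans
      (mul_le_mul_of_nonneg_right (h t ht) (norm_nonneg x))
  refine squeeze_zero_norm' hb ?_
  have h1 : Tendsto (fun t : ℝ => Real.exp (-(c * t))) atTop (𝓝 0) :=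
    Real.tendsto_exp_neg_atTop_nhds_zero.comp (tendsto_id.const_mul_atTop hc)
  simpa using (h1.const_mul C).mul_const ‖x‖

variable [CompleteSpace E]

theorem hasDerivAt_exp_smul_apply (A : E →L[ℝ] E) (x : E) (t : ℝ) :
    HasDerivAt (fun t : ℝ => NormedSpace.exp (t • A) x) (A (NormedSpace.exp (t • A) x)) t := by
  simpa using (hasDerivAt_exp_smul_const' (𝕂 := ℝ) A t).clm_apply (hasDerivAt_const t x)

theorem exp_smul_exp_neg_smul_apply (A : E →L[ℝ] E) (t : ℝ) (x : E) :
    NormedSpace.exp (t • A) (NormedSpace.exp ((-t) • A) x) = x := by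
  have h := NormedSpace.exp_add_smul A t (-t)
  rw [add_neg_cancel, zero_smul, NormedSpace.exp_zero] at h
  exact (congrArg (fun f : E →L[ℝ] E => f x) h).symm

/-- The Gramian `∫_0^∞ (e^{sA})^* e^{sA} ds`. -/
noncomputable def lyapunovOp (A : E →L[ℝ] E) : E →L[ℝ] E :=
  ∫ s in Set.Ioi (0 : ℝ),
    ContinuousLinearMap.adjoint (NormedSpace.exp (s • A)) ∘L NormedSpace.exp (s • A)

theorem continuous_inner_lyapunovOp_self (A : E →L[ℝ] E) :
    Continuous fun x : E => (inner ℝ x (lyapunovOp A x) : ℝ) := by fun_prop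

namespace ExpStable

variable {A : E →L[ℝ] E}

theorem integrableOn_adjoint_comp (hA : ExpStable A) :
    IntegrableOn (fun s : ℝ => ContinuousLinearMap.adjoint (NormedSpace.exp (s • A)) ∘L
      NormedSpace.exp (s • A)) (Set.Ioi 0) := by
  obtain ⟨C, c, hC, hc, h⟩ := hA
  have hcont : Continuous fun s : ℝ => ContinuousLinearMap.adjoint (NormedSpace.exp (s • A)) ∘L
      NormedSpace.exp (s • A) :=
    (ContinuousLinearMap.adjoint.continuous.comp (NormedSpace.continuous_exp_smul A)).clm_comp
      (NormedSpace.continuous_exp_smul A)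
  have hg : IntegrableOn (fun s : ℝ => C ^ 2 * Real.exp (-(2 * c) * s)) (Set.Ioi 0) :=
    (exp_neg_integrableOn_Ioi 0 (by positivity)).const_mul _
  refine Integrable.mono' hg hcont.aestronglyMeasurable ?_
  filter_upwards [ae_restrict_mem measurableSet_Ioi] with s hs
  have hs' := h s (le_of_lt hs)
  calc _ ≤ ‖NormedSpace.exp (s • A)‖ * ‖NormedSpace.exp (s • A)‖ := by
        refine (ContinuousLinearMap.opNorm_comp_le _ _).trans_eq ?_
        rw [LinearIsometryEquiv.norm_map]
    _ ≤ (C * Real.exp (-(c * s))) * (C * Real.exp (-(c * s))) :=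
        mul_le_mul hs' hs' (norm_nonneg _) (by positivity)
    _ = C ^ 2 * Real.exp (-(2 * c) * s) := by
        rw [mul_mul_mul_comm, ← Real.exp_add]
        ring_nf

theorem integrableOn_inner (hA : ExpStable A) (x y : E) :
    IntegrableOn (fun s : ℝ => inner ℝ (NormedSpace.exp (s • A) x) (NormedSpace.exp (s • A) y))
      (Set.Ioi 0) := by
  have h := ((innerSL ℝ x).comp (ContinuousLinearMap.apply ℝ E y)).integrable_comp
    hA.integrableOn_adjoint_comp
  refine h.congr (Filter.Eventually.of_forall fun s => ?_)
  simp [ContinuousLinearMap.adjoint_inner_right]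

theorem inner_lyapunovOp (hA : ExpStable A) (x y : E) :
    inner ℝ x (lyapunovOp A y) =
      ∫ s in Set.Ioi (0 : ℝ),
        inner ℝ (NormedSpace.exp (s • A) x) (NormedSpace.exp (s • A) y) := by
  have h := ((innerSL ℝ x).comp (ContinuousLinearMap.apply ℝ E y)).integral_comp_comm
    hA.integrableOn_adjoint_comp
  rw [lyapunovOp]
  refine Eq.trans (Eq.trans ?_ h.symm) ?_
  · simp
  · simp [ContinuousLinearMap.adjoint_inner_right]

theorem inner_lyapunovOp_comm (hA : ExpStable A) (x y : E) :
    inner ℝ x (lyapunovOp A y) = inner ℝ y (lyapunovOp A x) := by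
  rw [hA.inner_lyapunovOp, hA.inner_lyapunovOp]
  simp_rw [real_inner_comm]

theorem inner_lyapunovOp_self_nonneg (hA : ExpStable A) (x : E) :
    0 ≤ inner ℝ x (lyapunovOp A x) := by
  rw [hA.inner_lyapunovOp]
  exact integral_nonneg fun s => real_inner_self_nonneg

/-- The Lyapunov equation `A^* T + T A = -1`. -/
theorem two_mul_inner_lyapunovOp (hA : ExpStable A) (x : E) :
    2 * inner ℝ (A x) (lyapunovOp A x) = -‖x‖ ^ 2 := by
  -- Integrate the derivative of `|e^{sA} x|²` over `(0, ∞)`: only the boundary value `-|x|²` at `0`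
  -- survives.
  have hderiv : ∀ s ∈ Set.Ici (0 : ℝ), HasDerivAt (fun s : ℝ => ‖NormedSpace.exp (s • A) x‖ ^ 2)
      (2 * inner ℝ (NormedSpace.exp (s • A) (A x)) (NormedSpace.exp (s • A) x)) s := by
    intro s _
    have := (hasDerivAt_exp_smul_apply A x s).norm_sq
    rwa [← exp_smul_commute_apply, real_inner_comm] at this
  have hlim : Filter.Tendsto (fun s : ℝ => ‖NormedSpace.exp (s • A) x‖ ^ 2) Filter.atTop
      (nhds 0) := by
    simpa using (hA.tendsto_exp_smul_apply x).norm.pow 2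
  have h := integral_Ioi_of_hasDerivAt_of_tendsto' hderiv
    ((hA.integrableOn_inner (A x) x).const_mul 2) hlim
  rw [integral_const_mul, ← hA.inner_lyapunovOp] at h
  simpa using h

theorem inner_lyapunovOp_self_add (hA : ExpStable A) (x y : E) :
    inner ℝ (x + y) (lyapunovOp A (x + y)) =
      inner ℝ x (lyapunovOp A x) + 2 * inner ℝ x (lyapunovOp A y) +
        inner ℝ y (lyapunovOp A y) := by
  simp only [map_add, inner_add_left, inner_add_right]
  rw [hA.inner_lyapunovOp_comm y x]
  ring

theorem inner_lyapunovOp_self_le (x : E) :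
    inner ℝ x (lyapunovOp A x) ≤ ‖lyapunovOp A‖ * ‖x‖ ^ 2 := by
  refine (real_inner_le_norm _ _).trans ?_
  calc ‖x‖ * ‖lyapunovOp A x‖ ≤ ‖x‖ * (‖lyapunovOp A‖ * ‖x‖) := by
        gcongr; exact ContinuousLinearMap.le_opNorm _ _
    _ = _ := by ring

/-- Young's inequality for the form of `T`: expand `V(δ x - y) ≥ 0` and divide by `δ`. -/
theorem two_mul_inner_lyapunovOp_le (hA : ExpStable A) {δ : ℝ} (hδ : 0 < δ) (x y : E) :
    2 * inner ℝ x (lyapunovOp A y) ≤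
      δ * inner ℝ x (lyapunovOp A x) + δ⁻¹ * inner ℝ y (lyapunovOp A y) := by
  have h := hA.inner_lyapunovOp_self_nonneg (δ • x + -y)
  rw [hA.inner_lyapunovOp_self_add] at h
  simp only [map_smul, map_neg, inner_smul_left, inner_smul_right, inner_neg_left,
    inner_neg_right, conj_trivial] at h
  have h2 := mul_nonneg (inv_nonneg.2 hδ.le) h
  have h3 : δ⁻¹ * δ = 1 := inv_mul_cancel₀ hδ.ne'
  calc _ = _ - δ⁻¹ * (δ * (δ * inner ℝ x (lyapunovOp A x)) +
      2 * (δ * -inner ℝ x (lyapunovOp A y)) + - -inner ℝ y (lyapunovOp A y)) := by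
        rw [eq_sub_iff_add_eq]
        linear_combination (δ * inner ℝ x (lyapunovOp A x)
          - 2 * inner ℝ x (lyapunovOp A y)) * h3
    _ ≤ _ := sub_le_self _ (by simpa using h2)

/-- The Gramian is coercive. -/
theorem exists_norm_sq_le (hA : ExpStable A) :
    ∃ κ : ℝ, 0 < κ ∧ ∀ x, ‖x‖ ^ 2 ≤ κ * inner ℝ x (lyapunovOp A x) := by
  set l : ℝ := ‖lyapunovOp A‖ * ‖A‖ ^ 2 + 1 with hl
  have hl0 : 0 < l := by positivity
  -- By the Lyapunov equation, `0 ≤ V(l x + A x) = l² V(x) - l |x|² + V(A x)`. The choice of `l`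
  -- gives `V(A x) ≤ (l - 1)|x|²`, leaving `|x|² ≤ l² V(x)`.
  refine ⟨l ^ 2, by positivity, fun x => ?_⟩
  have h := hA.inner_lyapunovOp_self_nonneg (l • x + A x)
  rw [hA.inner_lyapunovOp_self_add] at h
  have h1 := hA.two_mul_inner_lyapunovOp x
  rw [hA.inner_lyapunovOp_comm (A x) x] at h1
  simp only [map_smul, inner_smul_left, inner_smul_right, conj_trivial] at h
  have h2 : inner ℝ (A x) (lyapunovOp A (A x)) ≤ (l - 1) * ‖x‖ ^ 2 := by
    refine (inner_lyapunovOp_self_le (A x)).trans ?_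
    rw [hl, add_sub_cancel_right, mul_assoc, ← mul_pow]
    gcongr
    exact A.le_opNorm x
  nlinarith

end ExpStable

end LyapunovOperator

/-! ### Deterministic estimates along a single path. -/

section Pathwise

theorem norm_add_sq_le_two_mul {E : Type*} [SeminormedAddCommGroup E] (x y : E) :
    ‖x + y‖ ^ 2 ≤ 2 * ‖x‖ ^ 2 + 2 * ‖y‖ ^ 2 := by
  have := pow_le_pow_left₀ (norm_nonneg _) (norm_add_le x y) 2
  nlinarith [sq_nonneg (‖x‖ - ‖y‖)]

/-- A linear differential inequality, integrated. -/
theorem le_exp_mul_add_integral_of_deriv_le {q q' g : ℝ → ℝ} {c : ℝ}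
    (hq : ∀ t, HasDerivAt q (q' t) t) (hg : Continuous g)
    (hle : ∀ t, 0 ≤ t → q' t ≤ -c * q t + g t) {t : ℝ} (ht : 0 ≤ t) :
    q t ≤ Real.exp (-(c * t)) * q 0 + ∫ s in (0 : ℝ)..t, Real.exp (-(c * (t - s))) * g s := by
  have hgc : Continuous fun s => Real.exp (c * s) * g s := by fun_prop
  have hderiv : ∀ t, HasDerivAt
      (fun t => Real.exp (c * t) * q t - ∫ s in (0 : ℝ)..t, Real.exp (c * s) * g s)
      (Real.exp (c * t) * (c * q t + q' t - g t)) t := by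
    intro t
    have h1 : HasDerivAt (fun t => Real.exp (c * t)) (Real.exp (c * t) * c) t := by
      simpa using ((hasDerivAt_id t).const_mul c).exp
    have h2 := intervalIntegral.integral_hasDerivAt_right (hgc.intervalIntegrable 0 t)
      (hgc.stronglyMeasurableAtFilter _ _) hgc.continuousAt
    convert! (h1.mul (hq t)).sub h2 using 1
    ring
  have hanti : AntitoneOn
      (fun t => Real.exp (c * t) * q t - ∫ s in (0 : ℝ)..t, Real.exp (c * s) * g s)
      (Set.Ici 0) := by
    refine antitoneOn_of_deriv_nonpos (convex_Ici 0)
      (fun t _ => (hderiv t).continuousAt.continuousWithinAt)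
      (fun t _ => (hderiv t).differentiableAt.differentiableWithinAt) ?_
    intro t ht
    rw [interior_Ici] at ht
    rw [(hderiv t).deriv]
    exact mul_nonpos_of_nonneg_of_nonpos (Real.exp_pos _).le (by linarith [hle t (le_of_lt ht)])
  have h := hanti Set.self_mem_Ici ht ht
  simp only [mul_zero, Real.exp_zero, one_mul, intervalIntegral.integral_same, sub_zero] at h
  have h3 : ∫ s in (0 : ℝ)..t, Real.exp (-(c * (t - s))) * g s =
      Real.exp (-(c * t)) * ∫ s in (0 : ℝ)..t, Real.exp (c * s) * g s := by
    rw [← intervalIntegral.integral_const_mul]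
    congr 1
    ext s
    rw [← mul_assoc, ← Real.exp_add]
    ring_nf
  rw [h3, ← mul_add]
  have h4 : Real.exp (-(c * t)) * (Real.exp (c * t) * q t) = q t := by
    rw [← mul_assoc, ← Real.exp_add]; simp
  rw [← h4]
  gcongr
  linarith

variable {E : Type*} [NormedAddCommGroup E] [InnerProductSpace ℝ E]

/-- The solution of `G' = A G + b` with `G 0 = 0`. -/
noncomputable def duhamel (A : E →L[ℝ] E) (b : ℝ → E) (t : ℝ) : E :=
  NormedSpace.exp (t • A) (∫ s in (0 : ℝ)..t, NormedSpace.exp ((-s) • A) (b s))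

@[simp]
theorem duhamel_zero (A : E →L[ℝ] E) (b : ℝ → E) : duhamel A b 0 = 0 := by simp [duhamel]

/-- The Ornstein-Uhlenbeck path `z_t = b_t + A ∫_0^t e^{(t-s)A} b_s ds`, that is, the solution of
`z_t = ∫_0^t A z_s ds + b_t`. -/
noncomputable def ouPath (A : E →L[ℝ] E) (b : ℝ → E) (t : ℝ) : E := b t + A (duhamel A b t)

variable [CompleteSpace E] {A : E →L[ℝ] E}

/-- The Lyapunov estimate for the perturbed linear equation `y' = A y + f`. -/
theorem ExpStable.inner_lyapunovOp_le_of_hasDerivAt (hA : ExpStable A) {c ε : ℝ}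
    (hc : c * ‖lyapunovOp A‖ ≤ 1 / 4) (hc0 : 0 ≤ c) (hε : 2 * ‖lyapunovOp A‖ ^ 2 * ε ≤ 1 / 4)
    {y f : ℝ → E} {g : ℝ → ℝ} (hy : ∀ t, HasDerivAt y (A (y t) + f t) t) (hg : Continuous g)
    (hf : ∀ t, 0 ≤ t → ‖f t‖ ^ 2 ≤ ε * ‖y t‖ ^ 2 + g t) {t : ℝ} (ht : 0 ≤ t) :
    inner ℝ (y t) (lyapunovOp A (y t)) ≤
      Real.exp (-(c * t)) * inner ℝ (y 0) (lyapunovOp A (y 0)) +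
        ∫ s in (0 : ℝ)..t, Real.exp (-(c * (t - s))) * (2 * ‖lyapunovOp A‖ ^ 2 * g s) := by
  refine le_exp_mul_add_integral_of_deriv_le
    (q := fun t => inner ℝ (y t) (lyapunovOp A (y t)))
    (q' := fun t => -‖y t‖ ^ 2 + 2 * inner ℝ (f t) (lyapunovOp A (y t))) ?_ (by fun_prop) ?_ ht
  · intro t
    have h := (hy t).inner ℝ ((lyapunovOp A).hasFDerivAt.comp_hasDerivAt t (hy t))
    refine h.congr_deriv ?_
    simp only [Function.comp_apply]
    rw [← hA.two_mul_inner_lyapunovOp, hA.inner_lyapunovOp_comm (y t), inner_add_left]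
    ring
  · intro t ht
    have h1 : inner ℝ (f t) (lyapunovOp A (y t)) ≤ ‖f t‖ * (‖lyapunovOp A‖ * ‖y t‖) :=
      (real_inner_le_norm _ _).trans
        (mul_le_mul_of_nonneg_left (ContinuousLinearMap.le_opNorm _ _) (norm_nonneg _))
    have h2 : c * inner ℝ (y t) (lyapunovOp A (y t)) ≤ 1 / 4 * ‖y t‖ ^ 2 := by
      calc _ ≤ c * (‖lyapunovOp A‖ * ‖y t‖ ^ 2) :=
            mul_le_mul_of_nonneg_left (inner_lyapunovOp_self_le _) hc0
        _ = c * ‖lyapunovOp A‖ * ‖y t‖ ^ 2 := by ring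
        _ ≤ _ := mul_le_mul_of_nonneg_right hc (sq_nonneg _)
    have h3 : 2 * ‖lyapunovOp A‖ ^ 2 * ‖f t‖ ^ 2 ≤
        2 * ‖lyapunovOp A‖ ^ 2 * (ε * ‖y t‖ ^ 2 + g t) :=
      mul_le_mul_of_nonneg_left (hf t ht) (by positivity)
    have h4 : 2 * ‖lyapunovOp A‖ ^ 2 * ε * ‖y t‖ ^ 2 ≤ 1 / 4 * ‖y t‖ ^ 2 :=
      mul_le_mul_of_nonneg_right hε (sq_nonneg _)
    -- With `N = ‖T‖`, `2N|f||y| ≤ |y|²/2 + 2N²|f|²`. Of the dissipation `-|y|²`, this uses one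
    -- half, the `ε` term a quarter, and `-c V(y)` the last quarter.
    have h5 := sq_nonneg (2 * (‖lyapunovOp A‖ * ‖f t‖) - ‖y t‖)
    nlinarith

theorem continuous_exp_neg_smul_apply (A : E →L[ℝ] E) {b : ℝ → E} (hb : Continuous b) :
    Continuous fun s : ℝ => NormedSpace.exp ((-s) • A) (b s) :=
  ((NormedSpace.continuous_exp_smul A).comp continuous_neg).clm_apply hb

theorem hasDerivAt_duhamel (A : E →L[ℝ] E) {b : ℝ → E} (hb : Continuous b) (t : ℝ) :
    HasDerivAt (duhamel A b) (A (duhamel A b t) + b t) t := by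
  have hc := continuous_exp_neg_smul_apply A hb
  have h1 := intervalIntegral.integral_hasDerivAt_right (hc.intervalIntegrable 0 t)
      (hc.stronglyMeasurableAtFilter _ _) hc.continuousAt
  have h2 := (hasDerivAt_exp_smul_const' (𝕂 := ℝ) A t).clm_apply h1
  rw [exp_smul_exp_neg_smul_apply] at h2
  exact h2

theorem continuous_duhamel (A : E →L[ℝ] E) {b : ℝ → E} (hb : Continuous b) :
    Continuous (duhamel A b) :=
  continuous_iff_continuousAt.2 fun t => (hasDerivAt_duhamel A hb t).continuousAt

theorem continuous_ouPath (A : E →L[ℝ] E) {b : ℝ → E} (hb : Continuous b) :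
    Continuous (ouPath A b) :=
  hb.add (A.continuous.comp (continuous_duhamel A hb))

/-- Control of the Ornstein-Uhlenbeck path by the increments of the driving path. -/
theorem ExpStable.norm_ouPath_sq_le (hA : ExpStable A) {c κ : ℝ}
    (hc : c * ‖lyapunovOp A‖ ≤ 1 / 4) (hc0 : 0 ≤ c) (hκ : 0 ≤ κ)
    (hκA : ∀ x, ‖x‖ ^ 2 ≤ κ * inner ℝ x (lyapunovOp A x))
    {b : ℝ → E} (hb : Continuous b) {t : ℝ} (ht : 0 ≤ t) :
    ‖ouPath A b t‖ ^ 2 ≤ 2 * κ * (∫ s in (0 : ℝ)..t, Real.exp (-(c * (t - s))) *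
        (2 * ‖lyapunovOp A‖ ^ 2 * (‖A‖ ^ 2 * ‖b s - b t‖ ^ 2))) +
      2 * (‖NormedSpace.exp (t • A)‖ ^ 2 * ‖b t‖ ^ 2) := by
  -- Freezing the endpoint value `b t` makes the forcing `A (b s - b t)`, whose size is governed by
  -- `t - s`, and makes `y` vanish at `0`.
  set y : ℝ → E := fun s => A (duhamel A b s) + b t - NormedSpace.exp (s • A) (b t) with hy
  have hderiv : ∀ s, HasDerivAt y (A (y s) + A (b s - b t)) s := by
    intro s
    have h1 := A.hasFDerivAt.comp_hasDerivAt s (hasDerivAt_duhamel A hb s)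
    have h2 := (h1.add_const (b t)).sub (hasDerivAt_exp_smul_apply A (b t) s)
    refine h2.congr_deriv ?_
    simp only [hy, map_add, map_sub]
    abel
  have h := hA.inner_lyapunovOp_le_of_hasDerivAt (ε := 0) hc hc0 (by norm_num) hderiv
    (g := fun s => ‖A‖ ^ 2 * ‖b s - b t‖ ^ 2) (by fun_prop)
    (fun s _ => by
      rw [zero_mul, zero_add, ← mul_pow]
      gcongr
      exact A.le_opNorm _) ht
  have hy0 : y 0 = 0 := by simp [hy]
  rw [hy0, inner_zero_left, mul_zero, zero_add] at h
  have hz : ouPath A b t = y t + NormedSpace.exp (t • A) (b t) := by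
    simp only [hy, ouPath]; abel
  have h1 : ‖ouPath A b t‖ ^ 2 ≤ 2 * ‖y t‖ ^ 2 + 2 * ‖NormedSpace.exp (t • A) (b t)‖ ^ 2 := by
    rw [hz]
    exact norm_add_sq_le_two_mul _ _
  have h2 : ‖NormedSpace.exp (t • A) (b t)‖ ^ 2 ≤ ‖NormedSpace.exp (t • A)‖ ^ 2 * ‖b t‖ ^ 2 := by
    rw [← mul_pow]
    gcongr
    exact ContinuousLinearMap.le_opNorm _ _
  have h3 := (hκA (y t)).trans (mul_le_mul_of_nonneg_left h hκ)
  linarith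

/-- Along a solution `u` of the integral equation, the difference to the Ornstein-Uhlenbeck path
solves `y' = A y + F(u)`. -/
theorem exists_hasDerivAt_sub_ouPath {F : E → E} (hF : Continuous F) {u b : ℝ → E}
    (hu : Continuous u) (hb : Continuous b) {x : E}
    (heq : ∀ t, 0 ≤ t → u t = x + (∫ s in (0 : ℝ)..t, (A (u s) + F (u s))) + b t) :
    ∃ y f : ℝ → E, (∀ t, HasDerivAt y (A (y t) + f t) t) ∧ y 0 = x ∧
      (∀ t, 0 ≤ t → y t = u t - ouPath A b t) ∧ ∀ t, 0 ≤ t → f t = F (u t) := by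
  have hc : Continuous fun s => A (u s) + F (u s) := by fun_prop
  -- The nondifferentiable term `b` cancels in `u - ouPath A b`. This formula for the difference is
  -- differentiable at every real `t`, while the equation for `u` is known only for `t ≥ 0`.
  set y : ℝ → E := fun t => x + (∫ s in (0 : ℝ)..t, (A (u s) + F (u s))) - A (duhamel A b t)
    with hy
  have hyu : ∀ t, 0 ≤ t → y t = u t - ouPath A b t := by
    intro t ht
    simp only [hy, heq t ht, ouPath]
    abel
  -- The first summand vanishes for `t ≥ 0`; it keeps the differential equation exact for negative
  -- times.
  refine ⟨y, fun t => A (u t - y t - ouPath A b t) + F (u t), ?_, by simp [hy], hyu, ?_⟩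
  · intro t
    have h1 := intervalIntegral.integral_hasDerivAt_right (hc.intervalIntegrable 0 t)
      (hc.stronglyMeasurableAtFilter _ _) hc.continuousAt
    have h2 := A.hasFDerivAt.comp_hasDerivAt t (hasDerivAt_duhamel A hb t)
    refine ((h1.const_add x).sub h2).congr_deriv ?_
    simp only [ouPath, map_add, map_sub]
    abel
  · intro t ht
    simp [hyu t ht]

/-- The energy estimate for `y = u - z`. The splitting `|u|² ≤ 2|y|² + 2|z|²` is what doubles `ε`.
-/
theorem ExpStable.inner_lyapunovOp_sub_ouPath_le (hA : ExpStable A) {c ε K : ℝ}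
    (hc : c * ‖lyapunovOp A‖ ≤ 1 / 4) (hc0 : 0 ≤ c) (hε0 : 0 ≤ ε)
    (hε : 2 * ‖lyapunovOp A‖ ^ 2 * (2 * ε) ≤ 1 / 4)
    {F : E → E} (hF : Continuous F) (hFK : ∀ u, ‖F u‖ ^ 2 ≤ K + ε * ‖u‖ ^ 2) {u b : ℝ → E}
    (hu : Continuous u) (hb : Continuous b) {x : E}
    (heq : ∀ t, 0 ≤ t → u t = x + (∫ s in (0 : ℝ)..t, (A (u s) + F (u s))) + b t)
    {t : ℝ} (ht : 0 ≤ t) :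
    inner ℝ (u t - ouPath A b t) (lyapunovOp A (u t - ouPath A b t)) ≤
      Real.exp (-(c * t)) * inner ℝ x (lyapunovOp A x) +
        ∫ s in (0 : ℝ)..t, Real.exp (-(c * (t - s))) *
          (2 * ‖lyapunovOp A‖ ^ 2 * (K + 2 * ε * ‖ouPath A b s‖ ^ 2)) := by
  obtain ⟨y, f, hy, hy0, hyu, hf⟩ := exists_hasDerivAt_sub_ouPath (A := A) hF hu hb heq
  have hz := continuous_ouPath A hb
  have h := hA.inner_lyapunovOp_le_of_hasDerivAt hc hc0 hε hy
    (g := fun s => K + 2 * ε * ‖ouPath A b s‖ ^ 2) (by fun_prop) (fun s hs => by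
      have h1 : u s = y s + ouPath A b s := by rw [hyu s hs]; abel
      have h2 : ‖u s‖ ^ 2 ≤ 2 * ‖y s‖ ^ 2 + 2 * ‖ouPath A b s‖ ^ 2 := by
        rw [h1]
        exact norm_add_sq_le_two_mul _ _
      rw [hf s hs]
      have h3 := hFK (u s)
      have h4 := mul_le_mul_of_nonneg_left h2 hε0
      linarith) ht
  rwa [hyu t ht, hy0] at h

/-- With `e^{tA} x` also removed, the remainder starts at `0` and is forced by `F(u)` alone, so no
initial term appears. -/
theorem ExpStable.inner_lyapunovOp_remainder_le (hA : ExpStable A) {c : ℝ}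
    (hc : c * ‖lyapunovOp A‖ ≤ 1 / 4) (hc0 : 0 ≤ c)
    {F : E → E} (hF : Continuous F) {u b : ℝ → E}
    (hu : Continuous u) (hb : Continuous b) {x : E}
    (heq : ∀ t, 0 ≤ t → u t = x + (∫ s in (0 : ℝ)..t, (A (u s) + F (u s))) + b t)
    {t : ℝ} (ht : 0 ≤ t) :
    inner ℝ (u t - ouPath A b t - NormedSpace.exp (t • A) x)
        (lyapunovOp A (u t - ouPath A b t - NormedSpace.exp (t • A) x)) ≤
      ∫ s in (0 : ℝ)..t, Real.exp (-(c * (t - s))) *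
          (2 * ‖lyapunovOp A‖ ^ 2 * ‖F (u s)‖ ^ 2) := by
  obtain ⟨y, f, hy, hy0, hyu, hf⟩ := exists_hasDerivAt_sub_ouPath (A := A) hF hu hb heq
  have hr : ∀ s, HasDerivAt (fun s => y s - NormedSpace.exp (s • A) x)
      (A (y s - NormedSpace.exp (s • A) x) + f s) s := by
    intro s
    refine ((hy s).sub (hasDerivAt_exp_smul_apply A x s)).congr_deriv ?_
    rw [map_sub]
    abel
  have h := hA.inner_lyapunovOp_le_of_hasDerivAt (ε := 0) hc hc0 (by norm_num) hr
    (g := fun s => ‖F (u s)‖ ^ 2) (by fun_prop) (fun s hs => by simp [hf s hs]) ht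
  simpa [hyu t ht, hy0] using h

end Pathwise

/-! ### Joint measurability and Fubini for processes with continuous paths. -/

section Processes

variable {Ω : Type*} [MeasurableSpace Ω] {P : Measure Ω}

open Filter Topology in
/-- A process with almost surely continuous paths is jointly almost everywhere measurable. -/
theorem aemeasurable_uncurry_of_ae_continuous [SFinite P] {μ : Measure ℝ} [SFinite μ]
    {H : Type*} [TopologicalSpace H] [TopologicalSpace.PseudoMetrizableSpace H]
    [MeasurableSpace H] [BorelSpace H] {f : ℝ → Ω → H} (hm : ∀ t, AEMeasurable (f t) P)
    (hc : ∀ᵐ ω ∂P, Continuous fun t => f t ω) :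
    AEMeasurable (Function.uncurry f) (μ.prod P) := by
  choose M hM hMf using hm
  -- Approximation by processes that are piecewise constant on the grid of mesh `1 / (k + 1)`. Only
  -- countably many times occur, so one null set handles all the measurable modifications.
  have hgm : ∀ k : ℕ, Measurable fun p : ℝ × Ω => M ((⌊p.1 * (k + 1)⌋ : ℤ) / ((k : ℝ) + 1)) p.2 := by
    intro k
    have h1 : Measurable fun q : ℤ × Ω => M ((q.1 : ℝ) / ((k : ℝ) + 1)) q.2 :=
      measurable_from_prod_countable_right fun n => hM ((n : ℝ) / ((k : ℝ) + 1))
    have h2 : Measurable fun p : ℝ × Ω => ((⌊p.1 * (k + 1)⌋ : ℤ), p.2) :=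
      (Int.measurable_floor.comp (measurable_fst.mul_const _)).prodMk measurable_snd
    exact h1.comp h2
  refine aemeasurable_of_tendsto_metrizable_ae atTop (fun k => (hgm k).aemeasurable) ?_
  have h1 : ∀ᵐ ω ∂P, ∀ (k : ℕ) (n : ℤ), f ((n : ℝ) / ((k : ℝ) + 1)) ω = M (n / (k + 1)) ω :=
    ae_all_iff.2 fun k => ae_all_iff.2 fun n => hMf _
  have h2 : ∀ᵐ p ∂(μ.prod P), (Continuous fun t => f t p.2) ∧
      ∀ (k : ℕ) (n : ℤ), f ((n : ℝ) / ((k : ℝ) + 1)) p.2 = M (n / (k + 1)) p.2 :=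
    Measure.quasiMeasurePreserving_snd.ae (hc.and h1)
  filter_upwards [h2] with p hp
  have h3 : Tendsto (fun k : ℕ => ((⌊p.1 * (k + 1)⌋ : ℤ) : ℝ) / ((k : ℝ) + 1)) atTop
      (𝓝 p.1) := by
    rw [tendsto_iff_dist_tendsto_zero]
    refine squeeze_zero (fun _ => dist_nonneg) (fun k => ?_)
      tendsto_one_div_add_atTop_nhds_zero_nat
    have hk : (0 : ℝ) < k + 1 := by positivity
    rw [dist_comm, Real.dist_eq, show p.1 - (⌊p.1 * (k + 1)⌋ : ℤ) / ((k : ℝ) + 1) =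
      Int.fract (p.1 * (k + 1)) / (k + 1) by rw [← Int.self_sub_floor]; field_simp,
      abs_of_nonneg (div_nonneg (Int.fract_nonneg _) hk.le)]
    gcongr
    exact (Int.fract_lt_one _).le
  exact ((hp.1.tendsto p.1).comp h3).congr fun k => hp.2 k _

variable {H : Type*} [NormedAddCommGroup H] [NormedSpace ℝ H] [FiniteDimensional ℝ H]
  [MeasurableSpace H] [BorelSpace H]

theorem aestronglyMeasurable_uncurry_of_ae_continuous [SFinite P] {μ : Measure ℝ} [SFinite μ]
    {f : ℝ → Ω → H} (hm : ∀ t, AEMeasurable (f t) P) (hc : ∀ᵐ ω ∂P, Continuous fun t => f t ω) :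
    AEStronglyMeasurable (Function.uncurry f) (μ.prod P) :=
  have : ProperSpace H := FiniteDimensional.proper ℝ H
  (aemeasurable_uncurry_of_ae_continuous hm hc).aestronglyMeasurable

theorem aemeasurable_intervalIntegral_of_ae_continuous [SFinite P]
    {f : ℝ → Ω → H} (hm : ∀ t, AEMeasurable (f t) P) (hc : ∀ᵐ ω ∂P, Continuous fun t => f t ω)
    (a b : ℝ) : AEMeasurable (fun ω => ∫ s in a..b, f s ω) P := by
  have : ProperSpace H := FiniteDimensional.proper ℝ H
  have h : ∀ μ : Measure ℝ, SFinite μ → AEMeasurable (fun ω => ∫ s, f s ω ∂μ) P := fun μ _ =>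
    ((aestronglyMeasurable_uncurry_of_ae_continuous (μ := μ) hm hc).prod_swap.integral_prod_right'
      ).aemeasurable
  exact (h _ inferInstance).sub (h _ inferInstance)

theorem integrable_uncurry_of_ae_continuous [SFinite P] {f : ℝ → Ω → H} {b : ℝ → ℝ} {t : ℝ}
    (hm : ∀ t, AEMeasurable (f t) P) (hc : ∀ᵐ ω ∂P, Continuous fun t => f t ω)
    (hint : ∀ s, 0 ≤ s → s ≤ t → Integrable (f s) P)
    (hb : ∀ s, 0 ≤ s → s ≤ t → ∫ ω, ‖f s ω‖ ∂P ≤ b s) (hbc : Continuous b) :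
    Integrable (Function.uncurry f) ((volume.restrict (Set.Ioc 0 t)).prod P) := by
  have hs := aestronglyMeasurable_uncurry_of_ae_continuous
    (μ := volume.restrict (Set.Ioc 0 t)) hm hc
  rw [integrable_prod_iff hs]
  refine ⟨?_, ?_⟩
  · filter_upwards [ae_restrict_mem measurableSet_Ioc] with s hs
    exact hint s hs.1.le hs.2
  · refine Integrable.mono' (g := b) ((hbc.integrableOn_Icc (a := 0) (b := t)).mono_set
      Set.Ioc_subset_Icc_self) hs.norm.integral_prod_right' ?_
    filter_upwards [ae_restrict_mem measurableSet_Ioc] with s hs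
    rw [Real.norm_of_nonneg (integral_nonneg fun _ => norm_nonneg _)]
    exact hb s hs.1.le hs.2

/-- Fubini's theorem for a process with almost surely continuous paths and controlled first
moments. -/
theorem integral_intervalIntegral_of_ae_continuous [SFinite P] {f : ℝ → Ω → H} {b : ℝ → ℝ}
    {t : ℝ} (ht : 0 ≤ t)
    (hm : ∀ t, AEMeasurable (f t) P) (hc : ∀ᵐ ω ∂P, Continuous fun t => f t ω)
    (hint : ∀ s, 0 ≤ s → s ≤ t → Integrable (f s) P)
    (hb : ∀ s, 0 ≤ s → s ≤ t → ∫ ω, ‖f s ω‖ ∂P ≤ b s) (hbc : Continuous b) :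
    Integrable (fun ω => ∫ s in (0 : ℝ)..t, f s ω) P ∧
      ∫ ω, (∫ s in (0 : ℝ)..t, f s ω) ∂P = ∫ s in (0 : ℝ)..t, ∫ ω, f s ω ∂P := by
  have h := integrable_uncurry_of_ae_continuous hm hc hint hb hbc
  simp only [intervalIntegral.integral_of_le ht]
  exact ⟨h.integral_prod_right, (integral_integral_swap h).symm⟩

theorem integral_intervalIntegral_le_of_ae_continuous [SFinite P] {f : ℝ → Ω → ℝ} {b : ℝ → ℝ}
    {t : ℝ} (ht : 0 ≤ t) (h0 : ∀ s ω, 0 ≤ f s ω)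
    (hm : ∀ t, AEMeasurable (f t) P) (hc : ∀ᵐ ω ∂P, Continuous fun t => f t ω)
    (hint : ∀ s, 0 ≤ s → s ≤ t → Integrable (f s) P)
    (hb : ∀ s, 0 ≤ s → s ≤ t → ∫ ω, f s ω ∂P ≤ b s) (hbc : Continuous b) :
    Integrable (fun ω => ∫ s in (0 : ℝ)..t, f s ω) P ∧
      ∫ ω, (∫ s in (0 : ℝ)..t, f s ω) ∂P ≤ ∫ s in (0 : ℝ)..t, b s := by
  have hn : ∀ s ω, ‖f s ω‖ = f s ω := fun s ω => Real.norm_of_nonneg (h0 s ω)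
  have hb' : ∀ s, 0 ≤ s → s ≤ t → ∫ ω, ‖f s ω‖ ∂P ≤ b s := by simpa only [hn] using hb
  obtain ⟨h1, h2⟩ := integral_intervalIntegral_of_ae_continuous ht hm hc hint hb' hbc
  have h := integrable_uncurry_of_ae_continuous hm hc hint hb' hbc
  refine ⟨h1, h2.trans_le ?_⟩
  refine intervalIntegral.integral_mono_on ht ?_ (hbc.intervalIntegrable _ _)
    fun s hs => hb s hs.1 hs.2
  rw [intervalIntegrable_iff_integrableOn_Ioc_of_le ht]
  exact h.integral_prod_left

end Processes

/-! ### First and second moments of the Gaussian law. -/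

section Gaussian

variable {n : ℕ}

theorem integral_norm_sq_multivariateGaussian {r : ℝ} (hr : 0 ≤ r) :
    Integrable (fun x => ‖x‖ ^ 2)
        (multivariateGaussian 0 (r • (1 : Matrix (Fin n) (Fin n) ℝ))) ∧
      ∫ x, ‖x‖ ^ 2 ∂(multivariateGaussian 0 (r • (1 : Matrix (Fin n) (Fin n) ℝ))) = n * r := by
  set μ := multivariateGaussian 0 (r • (1 : Matrix (Fin n) (Fin n) ℝ)) with hμ
  have hS : (r • (1 : Matrix (Fin n) (Fin n) ℝ)).PosSemidef := Matrix.PosSemidef.one.smul hr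
  have hL : MemLp (id : EuclideanSpace ℝ (Fin n) → _) 2 μ := IsGaussian.memLp_two_id
  have hLi : ∀ i, MemLp (fun x : EuclideanSpace ℝ (Fin n) => x i) 2 μ := fun i =>
    (EuclideanSpace.proj (𝕜 := ℝ) i).comp_memLp' hL
  have hi : ∀ i, ∫ x : EuclideanSpace ℝ (Fin n), x i ∂μ = 0 := by
    intro i
    have h := (EuclideanSpace.proj (𝕜 := ℝ) i).integral_comp_comm
      (hL.integrable (by norm_num))
    have h0 : ∫ x : EuclideanSpace ℝ (Fin n), id x ∂μ = 0 := integral_id_multivariateGaussian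
    rw [h0] at h
    simpa using h
  refine ⟨hL.integrable_norm_pow (by norm_num), ?_⟩
  simp_rw [EuclideanSpace.norm_sq_eq, Real.norm_eq_abs, sq_abs]
  rw [integral_finsetSum _ fun i _ => (hLi i).integrable_sq]
  have hv : ∀ i, ∫ x : EuclideanSpace ℝ (Fin n), x i ^ 2 ∂μ = r := by
    intro i
    rw [← variance_of_integral_eq_zero (hLi i).aemeasurable (hi i),
      variance_eval_multivariateGaussian hS]
    simp
  simp [hv]

theorem integral_multivariateGaussian_zero (S : Matrix (Fin n) (Fin n) ℝ) :
    Integrable (fun x => x) (multivariateGaussian (0 : EuclideanSpace ℝ (Fin n)) S) ∧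
      ∫ x, x ∂(multivariateGaussian (0 : EuclideanSpace ℝ (Fin n)) S) = 0 :=
  ⟨IsGaussian.integrable_id, integral_id_multivariateGaussian⟩

end Gaussian

/-! ### The properties of `B W` that the estimates use. -/

section Noise

/-- A process on `[0, ∞)`, extended to `ℝ`, with continuous paths, started at zero, centered, and
with increments of variance at most `σ |t - s|`. -/
structure IsDiffusiveNoise {Ω : Type*} [MeasurableSpace Ω] {E : Type*} [NormedAddCommGroup E]
    [NormedSpace ℝ E] [MeasurableSpace E] (b : ℝ → Ω → E) (P : Measure Ω) (σ : ℝ) : Prop where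
  nonneg : 0 ≤ σ
  aemeasurable : ∀ t, AEMeasurable (b t) P
  cont : ∀ᵐ ω ∂P, Continuous fun t => b t ω
  zero : ∀ᵐ ω ∂P, b 0 ω = 0
  integrable : ∀ t, 0 ≤ t → Integrable (b t) P
  mean : ∀ t, 0 ≤ t → ∫ ω, b t ω ∂P = 0
  integrable_sq : ∀ s t, 0 ≤ s → s ≤ t → Integrable (fun ω => ‖b s ω - b t ω‖ ^ 2) P
  integral_sq_le : ∀ s t, 0 ≤ s → s ≤ t → ∫ ω, ‖b s ω - b t ω‖ ^ 2 ∂P ≤ σ * (t - s)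

variable {Ω : Type*} [MeasurableSpace Ω] {P : Measure Ω} {n : ℕ}
  {W : ℝ≥0 → Ω → EuclideanSpace ℝ (Fin n)}

theorem IsWienerProcess.ae_eq_sub (hW : IsWienerProcess W P) (t : ℝ≥0) : W t - W 0 =ᵐ[P] W t := by
  filter_upwards [hW.zero] with ω hω
  simp [hω]

theorem IsWienerProcess.aemeasurable (hW : IsWienerProcess W P) (t : ℝ≥0) :
    AEMeasurable (W t) P :=
  (hW.law 0 t zero_le).aemeasurable.congr (hW.ae_eq_sub t)

theorem IsWienerProcess.integrable_and_mean (hW : IsWienerProcess W P) (t : ℝ≥0) :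
    Integrable (W t) P ∧ ∫ ω, W t ω ∂P = 0 := by
  have hl := hW.law 0 t zero_le
  obtain ⟨h1, h2⟩ := integral_multivariateGaussian_zero
    ((((t : ℝ) - (0 : ℝ≥0)) • (1 : Matrix (Fin n) (Fin n) ℝ)))
  rw [← hl.map_eq] at h1 h2
  rw [integral_map hl.aemeasurable (by fun_prop)] at h2
  have h3 := h1.comp_aemeasurable hl.aemeasurable
  exact ⟨h3.congr (hW.ae_eq_sub t), (integral_congr_ae (hW.ae_eq_sub t)).symm.trans h2⟩

theorem IsWienerProcess.integrable_sq_and_integral (hW : IsWienerProcess W P) {s t : ℝ≥0}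
    (hst : s ≤ t) :
    Integrable (fun ω => ‖W t ω - W s ω‖ ^ 2) P ∧
      ∫ ω, ‖W t ω - W s ω‖ ^ 2 ∂P = n * ((t : ℝ) - s) := by
  have hl := hW.law s t hst
  have hst' : (s : ℝ) ≤ t := hst
  obtain ⟨h1, h2⟩ := integral_norm_sq_multivariateGaussian (n := n) (sub_nonneg.2 hst')
  rw [← hl.map_eq] at h1 h2
  rw [integral_map hl.aemeasurable (by fun_prop)] at h2
  exact ⟨h1.comp_aemeasurable hl.aemeasurable, h2⟩

theorem IsWienerProcess.isDiffusiveNoise (hW : IsWienerProcess W P) {E : Type*}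
    [NormedAddCommGroup E] [NormedSpace ℝ E] [MeasurableSpace E] [BorelSpace E]
    [SecondCountableTopology E] [CompleteSpace E]
    (B : EuclideanSpace ℝ (Fin n) →L[ℝ] E) :
    IsDiffusiveNoise (fun s ω => B (W s.toNNReal ω)) P (‖B‖ ^ 2 * n) where
  nonneg := by positivity
  aemeasurable t := B.continuous.measurable.comp_aemeasurable (hW.aemeasurable _)
  cont := by
    filter_upwards [hW.cont] with ω hω
    exact B.continuous.comp (hω.comp continuous_real_toNNReal)
  zero := by
    filter_upwards [hW.zero] with ω hω
    simp [hω]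
  integrable t _ := B.integrable_comp (hW.integrable_and_mean _).1
  mean t _ := by
    rw [B.integral_comp_comm (hW.integrable_and_mean _).1, (hW.integrable_and_mean _).2, map_zero]
  integrable_sq s t hs hst := by
    have h := (hW.integrable_sq_and_integral (Real.toNNReal_le_toNNReal hst)).1.const_mul (‖B‖ ^ 2)
    refine h.mono' ?_ (Filter.Eventually.of_forall fun ω => ?_)
    · have h1 : AEMeasurable (fun ω => B (W s.toNNReal ω) - B (W t.toNNReal ω)) P :=
        (B.continuous.measurable.comp_aemeasurable (hW.aemeasurable _)).sub
          (B.continuous.measurable.comp_aemeasurable (hW.aemeasurable _))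
      exact (h1.norm.pow_const 2).aestronglyMeasurable
    · rw [Real.norm_of_nonneg (by positivity), ← map_sub, ← mul_pow, norm_sub_rev (W t.toNNReal ω)]
      gcongr
      exact B.le_opNorm _
  integral_sq_le s t hs hst := by
    obtain ⟨h1, h2⟩ := hW.integrable_sq_and_integral (Real.toNNReal_le_toNNReal hst)
    rw [Real.coe_toNNReal s hs, Real.coe_toNNReal t (hs.trans hst)] at h2
    calc _ ≤ ∫ ω, ‖B‖ ^ 2 * ‖W t.toNNReal ω - W s.toNNReal ω‖ ^ 2 ∂P := by
          refine integral_mono_of_nonneg (Filter.Eventually.of_forall fun ω => by positivity)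
            (h1.const_mul _) (Filter.Eventually.of_forall fun ω => ?_)
          simp only
          rw [← map_sub, ← mul_pow, norm_sub_rev (W t.toNNReal ω)]
          gcongr
          exact B.le_opNorm _
      _ = _ := by rw [integral_const_mul, h2]; ring

end Noise

/-! ### Moments of the Ornstein-Uhlenbeck path. -/

section Moments

theorem integral_exp_neg_mul_sub_le {c t : ℝ} (hc : 0 < c) :
    ∫ s in (0 : ℝ)..t, Real.exp (-(c * (t - s))) ≤ 1 / c := by
  have hd : ∀ s ∈ Set.uIcc 0 t, HasDerivAt (fun s => Real.exp (-(c * (t - s))) / c)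
      (Real.exp (-(c * (t - s)))) s := by
    intro s _
    have h := ((((hasDerivAt_id s).const_sub t).const_mul c).neg.exp).div_const c
    refine h.congr_deriv ?_
    simp only [id]
    field_simp
    rfl
  rw [intervalIntegral.integral_eq_sub_of_hasDerivAt hd
    ((by fun_prop : Continuous fun s => Real.exp (-(c * (t - s)))).intervalIntegrable _ _)]
  have : 0 ≤ Real.exp (-(c * (t - 0))) / c := by positivity
  simp only [sub_self, mul_zero, neg_zero, Real.exp_zero]
  linarith

theorem mul_exp_neg_le {c r : ℝ} (hc : 0 < c) : Real.exp (-(c * r)) * r ≤ 1 / c := by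
  rw [le_div_iff₀ hc]
  have h1 := Real.add_one_le_exp (c * r)
  have h2 : Real.exp (-(c * r)) * Real.exp (c * r) = 1 := by rw [← Real.exp_add]; simp
  nlinarith [Real.exp_pos (-(c * r))]

/-- Half of the exponential absorbs the factor `t - s`; the other half is integrated. -/
theorem integral_exp_neg_mul_sub_mul_le {c t : ℝ} (hc : 0 < c) (ht : 0 ≤ t) :
    ∫ s in (0 : ℝ)..t, Real.exp (-(c * (t - s))) * (t - s) ≤ (1 / (c / 2)) * (1 / (c / 2)) := by
  calc _ ≤ ∫ s in (0 : ℝ)..t, Real.exp (-(c / 2 * (t - s))) * (1 / (c / 2)) := by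
        refine intervalIntegral.integral_mono_on ht
          ((by fun_prop : Continuous _).intervalIntegrable _ _)
          ((by fun_prop : Continuous _).intervalIntegrable _ _) fun s _ => ?_
        have h := mul_exp_neg_le (r := t - s) (half_pos hc)
        calc Real.exp (-(c * (t - s))) * (t - s)
            = Real.exp (-(c / 2 * (t - s))) * (Real.exp (-(c / 2 * (t - s))) * (t - s)) := by
              rw [← mul_assoc, ← Real.exp_add]; ring_nf
          _ ≤ _ := mul_le_mul_of_nonneg_left h (Real.exp_pos _).le
    _ ≤ _ := by
        rw [intervalIntegral.integral_mul_const]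
        exact mul_le_mul_of_nonneg_right (integral_exp_neg_mul_sub_le (half_pos hc))
          (by positivity)

variable {Ω : Type*} [MeasurableSpace Ω] {P : Measure Ω}

/-- Takes expectations in the pathwise Lyapunov estimates, whose right-hand sides are such weighted
integrals. -/
theorem integral_exp_weight_le [SFinite P] {h : ℝ → Ω → ℝ} {β : ℝ → ℝ} {c t : ℝ} (ht : 0 ≤ t)
    (h0 : ∀ s ω, 0 ≤ h s ω) (hm : ∀ t, AEMeasurable (h t) P)
    (hc : ∀ᵐ ω ∂P, Continuous fun t => h t ω)
    (hint : ∀ s, 0 ≤ s → s ≤ t → Integrable (h s) P)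
    (hb : ∀ s, 0 ≤ s → s ≤ t → ∫ ω, h s ω ∂P ≤ β s) (hβ : Continuous β) :
    Integrable (fun ω => ∫ s in (0 : ℝ)..t, Real.exp (-(c * (t - s))) * h s ω) P ∧
      ∫ ω, (∫ s in (0 : ℝ)..t, Real.exp (-(c * (t - s))) * h s ω) ∂P ≤
        ∫ s in (0 : ℝ)..t, Real.exp (-(c * (t - s))) * β s := by
  refine integral_intervalIntegral_le_of_ae_continuous ht
    (fun s ω => mul_nonneg (Real.exp_pos _).le (h0 s ω)) (fun s => (hm s).const_mul _) ?_
    (fun s hs hst => (hint s hs hst).const_mul _) (fun s hs hst => ?_) (by fun_prop)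
  · filter_upwards [hc] with ω hω
    fun_prop
  · rw [integral_const_mul]
    exact mul_le_mul_of_nonneg_left (hb s hs hst) (Real.exp_pos _).le

variable {E : Type*} [NormedAddCommGroup E] [InnerProductSpace ℝ E] [MeasurableSpace E]
  {A : E →L[ℝ] E} {b : ℝ → Ω → E} {σ : ℝ}

namespace IsDiffusiveNoise

theorem integrable_norm_sq (hb : IsDiffusiveNoise b P σ) {t : ℝ} (ht : 0 ≤ t) :
    Integrable (fun ω => ‖b t ω‖ ^ 2) P ∧ ∫ ω, ‖b t ω‖ ^ 2 ∂P ≤ σ * t := by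
  have h1 := hb.integrable_sq 0 t le_rfl ht
  have h2 := hb.integral_sq_le 0 t le_rfl ht
  have h3 : (fun ω => ‖b 0 ω - b t ω‖ ^ 2) =ᵐ[P] fun ω => ‖b t ω‖ ^ 2 := by
    filter_upwards [hb.zero] with ω hω
    simp [hω]
  rw [sub_zero] at h2
  exact ⟨h1.congr h3, (integral_congr_ae h3).symm.trans_le h2⟩

theorem ae_continuous_ouPath [CompleteSpace E] (hb : IsDiffusiveNoise b P σ) :
    ∀ᵐ ω ∂P, Continuous (ouPath A fun s => b s ω) := by
  filter_upwards [hb.cont] with ω hω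
  exact continuous_ouPath A hω

variable [FiniteDimensional ℝ E] [CompleteSpace E] [BorelSpace E]

theorem aemeasurable_ouPath [SFinite P] (hb : IsDiffusiveNoise b P σ) (t : ℝ) :
    AEMeasurable (fun ω => ouPath A (fun s => b s ω) t) P := by
  have : ProperSpace E := FiniteDimensional.proper ℝ E
  have h : AEMeasurable
      (fun ω => ∫ s in (0 : ℝ)..t, NormedSpace.exp ((-s) • A) (b s ω)) P := by
    refine aemeasurable_intervalIntegral_of_ae_continuous (fun s =>
      (ContinuousLinearMap.continuous _).measurable.comp_aemeasurable (hb.aemeasurable s)) ?_ 0 t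
    filter_upwards [hb.cont] with ω hω
    exact continuous_exp_neg_smul_apply A hω
  exact (hb.aemeasurable t).add (A.continuous.measurable.comp_aemeasurable
    ((ContinuousLinearMap.continuous _).measurable.comp_aemeasurable h))

theorem integrable_ouPath [IsProbabilityMeasure P] (hb : IsDiffusiveNoise b P σ) {t : ℝ}
    (ht : 0 ≤ t) :
    Integrable (fun ω => ouPath A (fun s => b s ω) t) P ∧
      ∫ ω, ouPath A (fun s => b s ω) t ∂P = 0 := by
  have : ProperSpace E := FiniteDimensional.proper ℝ E
  -- Fubini needs a bound on first moments continuous in `s`; it comes from `|b| ≤ 1 + |b|²`.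
  have hn : ∀ s, 0 ≤ s → ∫ ω, ‖b s ω‖ ∂P ≤ 1 + σ * s := by
    intro s hs
    obtain ⟨h1, h2⟩ := hb.integrable_norm_sq hs
    calc ∫ ω, ‖b s ω‖ ∂P ≤ ∫ ω, (1 + ‖b s ω‖ ^ 2) ∂P := by
          refine integral_mono (hb.integrable s hs).norm ((integrable_const _).add h1) fun ω => ?_
          simp only
          nlinarith [sq_nonneg (‖b s ω‖ - 1), sq_nonneg ‖b s ω‖]
      _ = 1 + ∫ ω, ‖b s ω‖ ^ 2 ∂P := by
          rw [integral_add (integrable_const _) h1]; simp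
      _ ≤ _ := by linarith
  obtain ⟨h1, h2⟩ := integral_intervalIntegral_of_ae_continuous (P := P) (t := t)
    (f := fun s ω => NormedSpace.exp ((-s) • A) (b s ω))
    (b := fun s => ‖NormedSpace.exp ((-s) • A)‖ * (1 + σ * s)) ht
    (fun s => (ContinuousLinearMap.continuous _).measurable.comp_aemeasurable (hb.aemeasurable s))
    (by filter_upwards [hb.cont] with ω hω
        exact continuous_exp_neg_smul_apply A hω)
    (fun s hs _ => ContinuousLinearMap.integrable_comp _ (hb.integrable s hs))
    (fun s hs _ => by
      calc _ ≤ ∫ ω, ‖NormedSpace.exp ((-s) • A)‖ * ‖b s ω‖ ∂P :=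
            integral_mono (ContinuousLinearMap.integrable_comp _ (hb.integrable s hs)).norm
              ((hb.integrable s hs).norm.const_mul _) fun ω =>
                ContinuousLinearMap.le_opNorm _ _
        _ ≤ _ := by
            rw [integral_const_mul]
            exact mul_le_mul_of_nonneg_left (hn s hs) (norm_nonneg _))
    (((NormedSpace.continuous_exp_smul A).comp continuous_neg).norm.mul (by fun_prop))
  have h3 : ∫ s in (0 : ℝ)..t, ∫ ω, NormedSpace.exp ((-s) • A) (b s ω) ∂P = 0 := by
    rw [intervalIntegral.integral_congr (g := fun _ => 0) fun s hs => ?_]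
    · simp
    · rw [Set.uIcc_of_le ht] at hs
      simp only
      rw [ContinuousLinearMap.integral_comp_comm _ (hb.integrable s hs.1), hb.mean s hs.1, map_zero]
  rw [h3] at h2
  have h4 := (A ∘L NormedSpace.exp (t • A)).integrable_comp h1
  have h5 := (A ∘L NormedSpace.exp (t • A)).integral_comp_comm h1
  rw [h2, map_zero] at h5
  refine ⟨(hb.integrable t ht).add h4, ?_⟩
  refine (integral_add (hb.integrable t ht) h4).trans ?_
  rw [h5, hb.mean t ht, add_zero]

end IsDiffusiveNoise

variable [FiniteDimensional ℝ E] [CompleteSpace E] [BorelSpace E]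

/-- Increments of variance at most `σ (t - s)` are weighted by `e^{-c(t-s)}`, and the boundary term
is at most `C² e^{-2c₀t} σ t`. Both are bounded uniformly in `t`, and independence of increments
plays no role. -/
theorem ExpStable.exists_ouPath_second_moment_le (hA : ExpStable A) {σ : ℝ} (hσ : 0 ≤ σ) :
    ∃ Z : ℝ, 0 ≤ Z ∧ ∀ (Ω : Type*) [MeasurableSpace Ω] (P : Measure Ω) [IsProbabilityMeasure P]
      (b : ℝ → Ω → E), IsDiffusiveNoise b P σ → ∀ t, 0 ≤ t →
        Integrable (fun ω => ‖ouPath A (fun s => b s ω) t‖ ^ 2) P ∧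
          ∫ ω, ‖ouPath A (fun s => b s ω) t‖ ^ 2 ∂P ≤ Z := by
  obtain ⟨C, c₀, hC, hc₀, hdecay⟩ := id hA
  obtain ⟨κ, hκ, hκA⟩ := hA.exists_norm_sq_le
  set c : ℝ := 1 / (4 * (‖lyapunovOp A‖ + 1)) with hc
  have hc0 : 0 < c := by positivity
  have hcT : c * ‖lyapunovOp A‖ ≤ 1 / 4 := by
    rw [hc, one_div_mul_eq_div, div_le_iff₀ (by positivity)]
    linarith
  set D : ℝ := 2 * ‖lyapunovOp A‖ ^ 2 * ‖A‖ ^ 2 with hD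
  have hD0 : 0 ≤ D := by positivity
  refine ⟨2 * κ * (D * σ * ((1 / (c / 2)) * (1 / (c / 2)))) + 2 * (C ^ 2 * σ * (1 / (2 * c₀))),
    by positivity, ?_⟩
  intro Ω _ P _ b hb t ht
  obtain ⟨hb1, hb2⟩ := hb.integrable_norm_sq ht
  obtain ⟨h1, h2⟩ := integral_exp_weight_le (P := P) (c := c) (t := t)
    (h := fun s ω => D * ‖b s ω - b t ω‖ ^ 2) (β := fun s => D * (σ * (t - s))) ht
    (fun s ω => by positivity)
    (fun s => ((((hb.aemeasurable s).sub (hb.aemeasurable t)).norm).pow_const 2).const_mul _)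
    (by filter_upwards [hb.cont] with ω hω
        fun_prop)
    (fun s hs hst => (hb.integrable_sq s t hs hst).const_mul _)
    (fun s hs hst => by
      rw [integral_const_mul]
      exact mul_le_mul_of_nonneg_left (hb.integral_sq_le s t hs hst) hD0)
    (by fun_prop)
  have h3 : ∫ s in (0 : ℝ)..t, Real.exp (-(c * (t - s))) * (D * (σ * (t - s))) ≤
      D * σ * ((1 / (c / 2)) * (1 / (c / 2))) := by
    calc _ = D * σ * ∫ s in (0 : ℝ)..t, Real.exp (-(c * (t - s))) * (t - s) := by
          rw [← intervalIntegral.integral_const_mul]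
          congr 1
          ext s
          ring
      _ ≤ _ := mul_le_mul_of_nonneg_left (integral_exp_neg_mul_sub_mul_le hc0 ht)
          (by positivity)
  set J : Ω → ℝ := fun ω => ∫ s in (0 : ℝ)..t, Real.exp (-(c * (t - s))) *
    (D * ‖b s ω - b t ω‖ ^ 2) with hJ
  have hbound : ∀ᵐ ω ∂P, ‖ouPath A (fun s => b s ω) t‖ ^ 2 ≤
      2 * κ * J ω + 2 * (‖NormedSpace.exp (t • A)‖ ^ 2 * ‖b t ω‖ ^ 2) := by
    filter_upwards [hb.cont] with ω hω
    have h := hA.norm_ouPath_sq_le hcT hc0.le hκ.le hκA hω ht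
    simpa only [hJ, hD, mul_assoc] using h
  have hGint : Integrable (fun ω => 2 * κ * J ω +
      2 * (‖NormedSpace.exp (t • A)‖ ^ 2 * ‖b t ω‖ ^ 2)) P :=
    (h1.const_mul _).add ((hb1.const_mul _).const_mul _)
  refine ⟨hGint.mono' ((hb.aemeasurable_ouPath t).norm.pow_const 2).aestronglyMeasurable ?_, ?_⟩
  · filter_upwards [hbound] with ω hω
    rwa [Real.norm_of_nonneg (by positivity)]
  · refine (integral_mono_of_nonneg (Filter.Eventually.of_forall fun ω => by positivity)
      hGint hbound).trans ?_
    rw [integral_add (h1.const_mul _) ((hb1.const_mul _).const_mul _), integral_const_mul,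
      integral_const_mul, integral_const_mul]
    have h4 : ‖NormedSpace.exp (t • A)‖ ^ 2 * ∫ ω, ‖b t ω‖ ^ 2 ∂P ≤
        C ^ 2 * σ * (1 / (2 * c₀)) := by
      have h5 : ‖NormedSpace.exp (t • A)‖ ^ 2 ≤ C ^ 2 * Real.exp (-(2 * c₀ * t)) := by
        refine (pow_le_pow_left₀ (norm_nonneg _) (hdecay t ht) 2).trans_eq ?_
        rw [mul_pow, ← Real.exp_nat_mul]
        congr 2
        push_cast
        ring
      calc _ ≤ C ^ 2 * Real.exp (-(2 * c₀ * t)) * (σ * t) :=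
            mul_le_mul h5 hb2 (integral_nonneg fun _ => by positivity) (by positivity)
        _ = C ^ 2 * σ * (Real.exp (-(2 * c₀ * t)) * t) := by ring
        _ ≤ _ := mul_le_mul_of_nonneg_left (mul_exp_neg_le (by positivity)) (by positivity)
    gcongr
    exact h2.trans h3

end Moments

/-! ### The drift estimate for the expectation of `V`. -/

section Solutions

variable {E : Type*} [NormedAddCommGroup E] [InnerProductSpace ℝ E] [FiniteDimensional ℝ E]
  [CompleteSpace E] [MeasurableSpace E] [BorelSpace E] {A : E →L[ℝ] E} {F : E → E}

/-- The process `u` is continuous and solves `u_t = x + ∫_0^t (A u_s + F(u_s)) ds + b_t`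
for `t ≥ 0`, almost surely. -/
structure IsPerturbedSolution {Ω : Type*} [MeasurableSpace Ω] (A : E →L[ℝ] E) (F : E → E)
    (P : Measure Ω) (b : ℝ → Ω → E) (x : E) (u : ℝ → Ω → E) : Prop where
  aemeasurable : ∀ t, AEMeasurable (u t) P
  cont : ∀ᵐ ω ∂P, Continuous fun t => u t ω
  eqn : ∀ᵐ ω ∂P, ∀ t : ℝ, 0 ≤ t →
    u t ω = x + (∫ s in (0 : ℝ)..t, (A (u s ω) + F (u s ω))) + b t ω

/-- The Lyapunov function decays along solutions of the perturbed linear equation. -/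
theorem ExpStable.exists_integral_lyapunov_le (hA : ExpStable A) (hF : Continuous F)
    (hFε : ∀ ε : ℝ, 0 < ε → ∃ K : ℝ, 0 ≤ K ∧ ∀ u, ‖F u‖ ^ 2 ≤ K + ε * ‖u‖ ^ 2)
    {σ : ℝ} (hσ : 0 ≤ σ) :
    ∃ K a : ℝ, 0 < K ∧ 0 < a ∧
      ∀ (Ω : Type*) [MeasurableSpace Ω] (P : Measure Ω) [IsProbabilityMeasure P]
        (b : ℝ → Ω → E), IsDiffusiveNoise b P σ →
      ∀ (x : E) (u : ℝ → Ω → E), IsPerturbedSolution A F P b x u → ∀ t : ℝ, 0 ≤ t →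
        Integrable (fun ω => (inner ℝ (u t ω) (lyapunovOp A (u t ω)) : ℝ)) P ∧
        ∫ ω, (inner ℝ (u t ω) (lyapunovOp A (u t ω)) : ℝ) ∂P ≤
          Real.exp (-(a * t)) * inner ℝ x (lyapunovOp A x) + K := by
  obtain ⟨κ, hκ, hκA⟩ := hA.exists_norm_sq_le
  obtain ⟨Z, hZ, hz2⟩ := hA.exists_ouPath_second_moment_le hσ
  set N : ℝ := ‖lyapunovOp A‖ with hN
  have hN0 : 0 ≤ N := norm_nonneg _
  -- `c` and `ε` are fixed by the two quarter budgets of the energy estimate; adding `1` keeps the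
  -- denominators positive when `N = 0`.
  set c : ℝ := 1 / (4 * (N + 1)) with hc
  have hc0 : 0 < c := by positivity
  have hcN : c * N ≤ 1 / 4 := by
    rw [hc, one_div_mul_eq_div, div_le_iff₀ (by positivity)]
    linarith
  set ε : ℝ := 1 / (16 * (N ^ 2 + 1)) with hε
  have hε0 : 0 < ε := by positivity
  have hεN : 2 * N ^ 2 * (2 * ε) ≤ 1 / 4 := by
    rw [hε, show 2 * N ^ 2 * (2 * (1 / (16 * (N ^ 2 + 1)))) = N ^ 2 / (4 * (N ^ 2 + 1)) by
      field_simp; ring, div_le_iff₀ (by positivity)]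
    linarith
  obtain ⟨K₀, hK₀, hFK⟩ := hFε ε hε0
  set D : ℝ := 2 * N ^ 2 with hD
  have hD0 : 0 ≤ D := by positivity
  set K₁ : ℝ := D * (K₀ + 2 * ε * Z) * (1 / c) with hK₁
  have hK₁0 : 0 ≤ K₁ := by positivity
  -- The part of the bound for `E|F(u)|²` free of `x`, from `|u|² ≤ 2κ V(u - z) + 2|z|²`.
  set K₂ : ℝ := K₀ + ε * (2 * (κ * K₁) + 2 * Z) with hK₂
  have hK₂0 : 0 ≤ K₂ := by positivity
  set C₃ : ℝ := D * (2 * ε * κ) with hC₃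
  have hC₃0 : 0 ≤ C₃ := by positivity
  -- Young's parameter, small enough that `δ C₃ t ≤ (c / 2) t` can be absorbed by halving the rate.
  set δ : ℝ := c / (2 * (C₃ + 1)) with hδ
  have hδ0 : 0 < δ := by positivity
  have hδC : δ * C₃ ≤ c / 2 := by
    rw [hδ, div_mul_eq_mul_div, div_le_div_iff₀ (by positivity) (by positivity)]
    nlinarith
  refine ⟨K₁ + δ * (D * K₂ * (1 / c)) + (δ⁻¹ + 1) * (N * Z) + 1, c / 2, by positivity,
    by positivity, ?_⟩
  intro Ω _ P _ b hb x u hu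
  set v : ℝ := inner ℝ x (lyapunovOp A x) with hv
  have hv0 : 0 ≤ v := hA.inner_lyapunovOp_self_nonneg x
  set z : ℝ → Ω → E := fun t ω => ouPath A (fun s => b s ω) t with hzdef
  have hzm : ∀ t, AEMeasurable (z t) P := fun t => hb.aemeasurable_ouPath t
  have hzc : ∀ᵐ ω ∂P, Continuous fun t => z t ω := hb.ae_continuous_ouPath
  have hzi : ∀ t, 0 ≤ t → Integrable (fun ω => ‖z t ω‖ ^ 2) P := fun t ht => (hz2 Ω P b hb t ht).1
  have hzZ : ∀ t, 0 ≤ t → ∫ ω, ‖z t ω‖ ^ 2 ∂P ≤ Z := fun t ht => (hz2 Ω P b hb t ht).2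
  have hVm := (continuous_inner_lyapunovOp_self A).measurable
  have hsec : ProperSpace E := FiniteDimensional.proper ℝ E
  have hym : ∀ t, AEMeasurable (fun ω => u t ω - z t ω) P := fun t =>
    (hu.aemeasurable t).sub (hzm t)
  have hVz : ∀ t, 0 ≤ t → Integrable (fun ω => (inner ℝ (z t ω) (lyapunovOp A (z t ω)) : ℝ)) P ∧
      ∫ ω, (inner ℝ (z t ω) (lyapunovOp A (z t ω)) : ℝ) ∂P ≤ N * Z := by
    intro t ht
    have h1 := (hzi t ht).const_mul N
    have h2 : Integrable (fun ω => (inner ℝ (z t ω) (lyapunovOp A (z t ω)) : ℝ)) P := by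
      refine h1.mono' (hVm.comp_aemeasurable (hzm t)).aestronglyMeasurable
        (Filter.Eventually.of_forall fun ω => ?_)
      rw [Real.norm_of_nonneg (hA.inner_lyapunovOp_self_nonneg _)]
      exact inner_lyapunovOp_self_le _
    refine ⟨h2, (integral_mono h2 h1 fun ω => inner_lyapunovOp_self_le _).trans ?_⟩
    rw [integral_const_mul]
    exact mul_le_mul_of_nonneg_left (hzZ t ht) hN0
  have hVy : ∀ t, 0 ≤ t →
      Integrable (fun ω => (inner ℝ (u t ω - z t ω) (lyapunovOp A (u t ω - z t ω)) : ℝ)) P ∧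
      ∫ ω, (inner ℝ (u t ω - z t ω) (lyapunovOp A (u t ω - z t ω)) : ℝ) ∂P ≤
        Real.exp (-(c * t)) * v + K₁ := by
    intro t ht
    obtain ⟨h1, h2⟩ := integral_exp_weight_le (P := P) (c := c) (t := t)
      (h := fun s ω => D * (K₀ + 2 * ε * ‖z s ω‖ ^ 2))
      (β := fun _ => D * (K₀ + 2 * ε * Z)) ht
      (fun s ω => by positivity)
      (fun s => ((((hzm s).norm.pow_const 2).const_mul _).const_add _).const_mul _)
      (by filter_upwards [hzc] with ω hω
          fun_prop)
      (fun s hs _ => ((integrable_const _).add ((hzi s hs).const_mul _)).const_mul _)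
      (fun s hs _ => by
        rw [integral_const_mul, integral_add (integrable_const _) ((hzi s hs).const_mul _),
          integral_const_mul, integral_const, probReal_univ, one_smul]
        have := hzZ s hs
        gcongr)
      (by fun_prop)
    have h3 : ∫ s in (0 : ℝ)..t, Real.exp (-(c * (t - s))) * (D * (K₀ + 2 * ε * Z)) ≤ K₁ := by
      rw [intervalIntegral.integral_mul_const, mul_comm, hK₁]
      exact mul_le_mul_of_nonneg_left (integral_exp_neg_mul_sub_le hc0) (by positivity)
    have hbound : ∀ᵐ ω ∂P, (inner ℝ (u t ω - z t ω) (lyapunovOp A (u t ω - z t ω)) : ℝ) ≤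
        Real.exp (-(c * t)) * v + ∫ s in (0 : ℝ)..t, Real.exp (-(c * (t - s))) *
          (D * (K₀ + 2 * ε * ‖z s ω‖ ^ 2)) := by
      filter_upwards [hb.cont, hu.cont, hu.eqn] with ω h1 h2 h3
      exact hA.inner_lyapunovOp_sub_ouPath_le hcN hc0.le hε0.le hεN hF hFK h2 h1 h3 ht
    have hG := (integrable_const (μ := P) (Real.exp (-(c * t)) * v)).add h1
    refine ⟨hG.mono' (hVm.comp_aemeasurable (hym t)).aestronglyMeasurable ?_, ?_⟩
    · filter_upwards [hbound] with ω hω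
      rwa [Real.norm_of_nonneg (hA.inner_lyapunovOp_self_nonneg _)]
    · refine (integral_mono_of_nonneg (Filter.Eventually.of_forall fun ω =>
        hA.inner_lyapunovOp_self_nonneg _) hG hbound).trans ?_
      refine (integral_add (integrable_const _) h1).trans_le ?_
      rw [integral_const, probReal_univ, one_smul]
      linarith
  have hFu : ∀ t, 0 ≤ t → Integrable (fun ω => ‖F (u t ω)‖ ^ 2) P ∧
      ∫ ω, ‖F (u t ω)‖ ^ 2 ∂P ≤ K₂ + 2 * ε * κ * (Real.exp (-(c * t)) * v) := by
    intro t ht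
    obtain ⟨h1, h2⟩ := hVy t ht
    have hI : Integrable (fun ω => 2 * (κ * inner ℝ (u t ω - z t ω)
        (lyapunovOp A (u t ω - z t ω))) + 2 * ‖z t ω‖ ^ 2) P :=
      ((h1.const_mul κ).const_mul 2).add ((hzi t ht).const_mul 2)
    have hG := (integrable_const (μ := P) K₀).add (hI.const_mul ε)
    have hbound : ∀ ω, ‖F (u t ω)‖ ^ 2 ≤ K₀ + ε * (2 * (κ * inner ℝ (u t ω - z t ω)
        (lyapunovOp A (u t ω - z t ω))) + 2 * ‖z t ω‖ ^ 2) := by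
      intro ω
      have h3 := norm_add_sq_le_two_mul (u t ω - z t ω) (z t ω)
      rw [sub_add_cancel] at h3
      have h4 := hκA (u t ω - z t ω)
      refine (hFK (u t ω)).trans ?_
      gcongr
      linarith
    have hFi : Integrable (fun ω => ‖F (u t ω)‖ ^ 2) P := by
      refine hG.mono' ((hF.measurable.comp_aemeasurable
        (hu.aemeasurable t)).norm.pow_const 2).aestronglyMeasurable
        (Filter.Eventually.of_forall fun ω => ?_)
      rw [Real.norm_of_nonneg (by positivity)]
      exact hbound ω
    refine ⟨hFi, (integral_mono hFi hG hbound).trans ?_⟩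
    refine (integral_add (integrable_const _) (hI.const_mul ε)).trans_le ?_
    rw [integral_const_mul, integral_add ((h1.const_mul κ).const_mul 2) ((hzi t ht).const_mul 2),
      integral_const_mul, integral_const_mul, integral_const_mul, integral_const,
      probReal_univ, one_smul]
    calc _ ≤ K₀ + ε * (2 * (κ * (Real.exp (-(c * t)) * v + K₁)) + 2 * Z) := by
          gcongr
          exact hzZ t ht
      _ = _ := by rw [hK₂]; ring
  intro t ht
  set S : E := NormedSpace.exp (t • A) x with hS
  -- `E|F(u_s)|²` depends on `x` through `e^{-cs} V(x)`; convolving with `e^{-c(t-s)}` gives `t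
  -- e^{-ct} V(x)`, whose factor `t` vanishes at time `0`.
  have hVr : Integrable (fun ω => (inner ℝ (u t ω - z t ω - S)
        (lyapunovOp A (u t ω - z t ω - S)) : ℝ)) P ∧
      ∫ ω, (inner ℝ (u t ω - z t ω - S) (lyapunovOp A (u t ω - z t ω - S)) : ℝ) ∂P ≤
        D * K₂ * (1 / c) + C₃ * (t * (Real.exp (-(c * t)) * v)) := by
    obtain ⟨h1, h2⟩ := integral_exp_weight_le (P := P) (c := c) (t := t)
      (h := fun s ω => D * ‖F (u s ω)‖ ^ 2)
      (β := fun s => D * (K₂ + 2 * ε * κ * (Real.exp (-(c * s)) * v))) ht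
      (fun s ω => by positivity)
      (fun s => ((hF.measurable.comp_aemeasurable
        (hu.aemeasurable s)).norm.pow_const 2).const_mul _)
      (by filter_upwards [hu.cont] with ω hω
          fun_prop)
      (fun s hs _ => (hFu s hs).1.const_mul _)
      (fun s hs _ => by
        rw [integral_const_mul]
        exact mul_le_mul_of_nonneg_left (hFu s hs).2 hD0)
      (by fun_prop)
    have h3 : ∫ s in (0 : ℝ)..t, Real.exp (-(c * (t - s))) *
        (D * (K₂ + 2 * ε * κ * (Real.exp (-(c * s)) * v))) ≤
        D * K₂ * (1 / c) + C₃ * (t * (Real.exp (-(c * t)) * v)) := by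
      have h4 : ∀ s : ℝ, Real.exp (-(c * (t - s))) *
          (D * (K₂ + 2 * ε * κ * (Real.exp (-(c * s)) * v))) =
          D * K₂ * Real.exp (-(c * (t - s))) + C₃ * (Real.exp (-(c * t)) * v) := by
        intro s
        have h5 : Real.exp (-(c * (t - s))) * Real.exp (-(c * s)) = Real.exp (-(c * t)) := by
          rw [← Real.exp_add]; ring_nf
        rw [hC₃]
        linear_combination D * (2 * ε * κ) * v * h5
      simp_rw [h4]
      rw [intervalIntegral.integral_add ((by fun_prop : Continuous _).intervalIntegrable _ _)
        (by simp), intervalIntegral.integral_const_mul, intervalIntegral.integral_const, sub_zero,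
        smul_eq_mul]
      have h6 := mul_le_mul_of_nonneg_left (integral_exp_neg_mul_sub_le (t := t) hc0)
        (mul_nonneg hD0 hK₂0)
      linarith
    have hbound : ∀ᵐ ω ∂P, (inner ℝ (u t ω - z t ω - S)
        (lyapunovOp A (u t ω - z t ω - S)) : ℝ) ≤
        ∫ s in (0 : ℝ)..t, Real.exp (-(c * (t - s))) * (D * ‖F (u s ω)‖ ^ 2) := by
      filter_upwards [hb.cont, hu.cont, hu.eqn] with ω h1 h2 h3
      exact hA.inner_lyapunovOp_remainder_le hcN hc0.le hF h2 h1 h3 ht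
    refine ⟨h1.mono' (hVm.comp_aemeasurable ((hym t).sub_const S)).aestronglyMeasurable ?_, ?_⟩
    · filter_upwards [hbound] with ω hω
      rwa [Real.norm_of_nonneg (hA.inner_lyapunovOp_self_nonneg _)]
    · exact (integral_mono_of_nonneg (Filter.Eventually.of_forall fun ω =>
        hA.inner_lyapunovOp_self_nonneg _) h1 hbound).trans (h2.trans h3)
  -- `S` is deterministic and `z` is centered, so this cross term costs nothing.
  have hcross : Integrable (fun ω => (inner ℝ S (lyapunovOp A (z t ω)) : ℝ)) P ∧
      ∫ ω, (inner ℝ S (lyapunovOp A (z t ω)) : ℝ) ∂P = 0 := by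
    obtain ⟨h1, h2⟩ := hb.integrable_ouPath (A := A) ht
    refine ⟨((innerSL ℝ S) ∘L lyapunovOp A).integrable_comp h1, ?_⟩
    refine (((innerSL ℝ S) ∘L lyapunovOp A).integral_comp_comm h1).trans ?_
    rw [h2, map_zero]
  -- Expand `V((u - z) + z)`, split `u - z = S + r` in the cross term, and apply Young to the `r`
  -- part only. Thus `V(u - z)` keeps coefficient `1`.
  have hbound : ∀ ω, (inner ℝ (u t ω) (lyapunovOp A (u t ω)) : ℝ) ≤
      inner ℝ (u t ω - z t ω) (lyapunovOp A (u t ω - z t ω)) +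
        (2 * inner ℝ S (lyapunovOp A (z t ω)) +
        (δ * inner ℝ (u t ω - z t ω - S) (lyapunovOp A (u t ω - z t ω - S)) +
        (δ⁻¹ + 1) * inner ℝ (z t ω) (lyapunovOp A (z t ω)))) := by
    intro ω
    have h1 := hA.inner_lyapunovOp_self_add (u t ω - z t ω) (z t ω)
    rw [sub_add_cancel] at h1
    have h2 := hA.two_mul_inner_lyapunovOp_le hδ0 (u t ω - z t ω - S) (z t ω)
    rw [inner_sub_left _ S] at h2
    rw [h1]
    linarith
  have hI3 := (hVr.1.const_mul δ).add ((hVz t ht).1.const_mul (δ⁻¹ + 1))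
  have hI2 := (hcross.1.const_mul 2).add hI3
  have hI := (hVy t ht).1.add hI2
  have hVu : Integrable (fun ω => (inner ℝ (u t ω) (lyapunovOp A (u t ω)) : ℝ)) P := by
    refine hI.mono' (hVm.comp_aemeasurable (hu.aemeasurable t)).aestronglyMeasurable
      (Filter.Eventually.of_forall fun ω => ?_)
    rw [Real.norm_of_nonneg (hA.inner_lyapunovOp_self_nonneg _)]
    exact hbound ω
  refine ⟨hVu, (integral_mono hVu hI hbound).trans ?_⟩
  have hsum : ∫ ω, (inner ℝ (u t ω - z t ω) (lyapunovOp A (u t ω - z t ω)) +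
        (2 * inner ℝ S (lyapunovOp A (z t ω)) +
        (δ * inner ℝ (u t ω - z t ω - S) (lyapunovOp A (u t ω - z t ω - S)) +
        (δ⁻¹ + 1) * inner ℝ (z t ω) (lyapunovOp A (z t ω))))) ∂P ≤
      (Real.exp (-(c * t)) * v + K₁) + (0 +
        (δ * (D * K₂ * (1 / c) + C₃ * (t * (Real.exp (-(c * t)) * v))) +
          (δ⁻¹ + 1) * (N * Z))) := by
    refine (integral_add (hVy t ht).1 hI2).trans_le (add_le_add (hVy t ht).2 ?_)
    refine (integral_add (hcross.1.const_mul 2) hI3).trans_le (add_le_add ?_ ?_)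
    · rw [integral_const_mul, hcross.2, mul_zero]
    refine (integral_add (hVr.1.const_mul δ) ((hVz t ht).1.const_mul _)).trans_le
      (add_le_add ?_ ?_)
    · rw [integral_const_mul]
      exact mul_le_mul_of_nonneg_left hVr.2 hδ0.le
    · rw [integral_const_mul]
      exact mul_le_mul_of_nonneg_left (hVz t ht).2 (by positivity)
  refine hsum.trans ?_
  -- Half of the decay rate pays for the linear factor, so the coefficient of `V(x)` is a pure
  -- exponential with value `1` at `t = 0`.
  have hexp : Real.exp (-(c * t)) * (1 + c / 2 * t) ≤ Real.exp (-(c / 2 * t)) := by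
    calc _ ≤ Real.exp (-(c * t)) * Real.exp (c / 2 * t) := by
          gcongr
          linarith [Real.add_one_le_exp (c / 2 * t)]
      _ = _ := by rw [← Real.exp_add]; ring_nf
  have h1 := mul_le_mul_of_nonneg_right hexp hv0
  have h2 : δ * C₃ * (t * (Real.exp (-(c * t)) * v)) ≤ c / 2 * (t * (Real.exp (-(c * t)) * v)) :=
    mul_le_mul_of_nonneg_right hδC (by positivity)
  linarith

end Solutions

/-! ### Translation of the hypotheses and conclusion. -/

/-- Since `dstar ≥ 1`, the exponent satisfies `2a ≤ 1`, so `|F(u)|²` grows at most linearly and is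
dominated by any multiple of `|u|²` up to a constant. -/
theorem GrowthCondition.exists_norm_sq_le {d dstar : ℕ}
    {F : EuclideanSpace ℝ (Fin d) → EuclideanSpace ℝ (Fin d)} (hdstar : 1 ≤ dstar)
    (hG : GrowthCondition dstar F) {ε : ℝ} (hε : 0 < ε) :
    ∃ K : ℝ, 0 ≤ K ∧ ∀ u, ‖F u‖ ^ 2 ≤ K + ε * ‖u‖ ^ 2 := by
  obtain ⟨a, ha0, ha, C, hC⟩ := hG
  have hds : (1 : ℝ) ≤ dstar := by exact_mod_cast hdstar
  have ha2 : a ≤ 1 / 2 := ha.le.trans (one_div_le_one_div_of_le (by norm_num) (by linarith))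
  have hC' : ∀ u, ‖F u‖ ≤ C * (1 + ‖u‖) ^ a := by
    intro u
    have h := hC ⟨u, rfl⟩
    have hpos : 0 < (1 + ‖u‖) ^ a := Real.rpow_pos_of_pos (by positivity) _
    simpa only [div_le_iff₀ hpos] using h
  have hsq : ∀ u, ‖F u‖ ^ 2 ≤ C ^ 2 * (1 + ‖u‖) := by
    intro u
    have h1 : (1 : ℝ) ≤ 1 + ‖u‖ := by linarith [norm_nonneg u]
    refine (pow_le_pow_left₀ (norm_nonneg _) (hC' u) 2).trans ?_
    rw [mul_pow, ← Real.rpow_natCast ((1 + ‖u‖) ^ a), ← Real.rpow_mul (by positivity)]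
    gcongr
    refine (Real.rpow_le_rpow_of_exponent_le h1 (?_ : _ ≤ (1 : ℝ))).trans_eq (Real.rpow_one _)
    push_cast
    linarith
  -- The second term comes from completing the square in `ε|u|² - C²|u|`.
  refine ⟨C ^ 2 + C ^ 4 / (4 * ε), by positivity, fun u => (hsq u).trans ?_⟩
  have h := sq_nonneg (C ^ 2 - 2 * ε * ‖u‖)
  have h2 : C ^ 2 * ‖u‖ ≤ C ^ 4 / (4 * ε) + ε * ‖u‖ ^ 2 := by
    rw [← sub_nonneg, show C ^ 4 / (4 * ε) + ε * ‖u‖ ^ 2 - C ^ 2 * ‖u‖ =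
      (C ^ 2 - 2 * ε * ‖u‖) ^ 2 / (4 * ε) by field_simp; ring]
    positivity
  linarith

theorem ExpStable.lyapunovV_eq {d : ℕ}
    {A : EuclideanSpace ℝ (Fin d) →L[ℝ] EuclideanSpace ℝ (Fin d)} (hA : ExpStable A)
    (x : EuclideanSpace ℝ (Fin d)) : lyapunovV A x = inner ℝ x (lyapunovOp A x) := by
  rw [hA.inner_lyapunovOp, lyapunovV]
  simp_rw [real_inner_self_eq_norm_sq]

theorem ExpStable.exists_posDef {d : ℕ}
    {A : EuclideanSpace ℝ (Fin d) →L[ℝ] EuclideanSpace ℝ (Fin d)} (hA : ExpStable A) :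
    ∃ M : Matrix (Fin d) (Fin d) ℝ, M.PosDef ∧
      ∀ x, lyapunovV A x = inner ℝ x (Matrix.toEuclideanCLM (𝕜 := ℝ) M x) := by
  obtain ⟨κ, hκ, hκA⟩ := hA.exists_norm_sq_le
  set M := (Matrix.toEuclideanCLM (n := Fin d) (𝕜 := ℝ)).symm (lyapunovOp A) with hM
  have hMA : Matrix.toEuclideanCLM (𝕜 := ℝ) M = lyapunovOp A := by simp [hM]
  refine ⟨M, Matrix.PosDef.of_dotProduct_mulVec_pos ?_ ?_, fun x => by rw [hMA, hA.lyapunovV_eq]⟩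
  · have h : ∀ i j, M i j = inner ℝ (EuclideanSpace.single i (1 : ℝ))
        (lyapunovOp A (EuclideanSpace.single j 1)) := by
      intro i j
      rw [← hMA, Matrix.inner_toEuclideanCLM]
      simp
    ext i j
    simp only [Matrix.conjTranspose_apply, star_trivial]
    rw [h, h, hA.inner_lyapunovOp_comm]
  · intro x hx
    have h := hκA (WithLp.toLp 2 x)
    rw [← hMA, Matrix.inner_toEuclideanCLM] at h
    have hx' : (WithLp.toLp 2 x : EuclideanSpace ℝ (Fin d)) ≠ 0 := by simpa using hx
    have h0 : 0 < ‖(WithLp.toLp 2 x : EuclideanSpace ℝ (Fin d))‖ ^ 2 := by positivity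
    simpa using pos_of_mul_pos_right (h0.trans_le h) hκ.le

/-- Processes are extended to negative times by their value at `0`, which preserves continuity; the
equation is only claimed for `t ≥ 0`. -/
theorem IsSDESolution.isPerturbedSolution {d n : ℕ} {Ω : Type*} [MeasurableSpace Ω]
    {A : EuclideanSpace ℝ (Fin d) →L[ℝ] EuclideanSpace ℝ (Fin d)}
    {F : EuclideanSpace ℝ (Fin d) → EuclideanSpace ℝ (Fin d)}
    {B : EuclideanSpace ℝ (Fin n) →L[ℝ] EuclideanSpace ℝ (Fin d)}
    {P : Measure Ω} {W : ℝ≥0 → Ω → EuclideanSpace ℝ (Fin n)}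
    {x : EuclideanSpace ℝ (Fin d)} {X : ℝ≥0 → Ω → EuclideanSpace ℝ (Fin d)}
    (hX : IsSDESolution A F B P W x X) :
    IsPerturbedSolution A F P (fun s ω => B (W s.toNNReal ω)) x fun s ω => X s.toNNReal ω where
  aemeasurable t := hX.aemeasurable _
  cont := by
    filter_upwards [hX.cont] with ω hω
    exact hω.comp continuous_real_toNNReal
  eqn := by
    filter_upwards [hX.eqn] with ω hω t ht
    have h := hω t.toNNReal
    rwa [Real.coe_toNNReal t ht] at h

theorem mainTheorem6 (d n : ℕ) (hn : 1 ≤ n) (hnd : n ≤ d)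
    (A : EuclideanSpace ℝ (Fin d) →L[ℝ] EuclideanSpace ℝ (Fin d))
    (B : EuclideanSpace ℝ (Fin n) →L[ℝ] EuclideanSpace ℝ (Fin d))
    (F : EuclideanSpace ℝ (Fin d) → EuclideanSpace ℝ (Fin d))
    (hF_smooth : ContDiff ℝ ((⊤ : ℕ∞) : WithTop ℕ∞) F) (hF_lip : ∃ L : ℝ≥0, LipschitzWith L F)
    (dstar : ℕ) (hdstar : 1 ≤ dstar) (hdstar_le : dstar ≤ d)
    (hD : Dissipative A) (hG : GrowthCondition dstar F) :
    (∀ x : EuclideanSpace ℝ (Fin d),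
      IntegrableOn (fun s : ℝ => ‖(NormedSpace.exp (s • A)) x‖ ^ 2) (Set.Ioi 0)) ∧
    (∃ M : Matrix (Fin d) (Fin d) ℝ, M.PosDef ∧
      ∀ x, lyapunovV A x = inner ℝ x (Matrix.toEuclideanCLM (𝕜 := ℝ) M x)) ∧
    ∃ K γ : ℝ, 0 < K ∧ 0 < γ ∧ γ < 1 ∧
      ∀ (Ω : Type*) [MeasurableSpace Ω] (P : Measure Ω) [IsProbabilityMeasure P]
        (W : ℝ≥0 → Ω → EuclideanSpace ℝ (Fin n)), IsWienerProcess W P →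
      ∀ (x : EuclideanSpace ℝ (Fin d)) (X : ℝ≥0 → Ω → EuclideanSpace ℝ (Fin d)),
        IsSDESolution A F B P W x X →
      ∀ t : ℝ≥0,
        Integrable (lyapunovV A) (P.map (X t)) ∧
        |∫ y, lyapunovV A y ∂(P.map (X t))| ≤ γ ^ (t : ℝ) * lyapunovV A x + K := by
  have hd : 1 ≤ d := hn.trans hnd
  have hA : ExpStable A := hD.exists_norm_exp_le hd
  refine ⟨fun x => ?_, hA.exists_posDef, ?_⟩
  · simpa only [real_inner_self_eq_norm_sq] using hA.integrableOn_inner x x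
  obtain ⟨K, a, hK, ha, h⟩ := hA.exists_integral_lyapunov_le hF_smooth.continuous
    (fun ε hε => hG.exists_norm_sq_le hdstar hε) (σ := ‖B‖ ^ 2 * n) (by positivity)
  -- With `γ = e^{-a}`, `γ^t` is the factor `e^{-at}` of the drift estimate.
  refine ⟨K, Real.exp (-a), hK, Real.exp_pos _, by simpa using ha, ?_⟩
  intro Ω _ P _ W hW x X hX t
  obtain ⟨h1, h2⟩ := h Ω P _ (hW.isDiffusiveNoise B) x _ hX.isPerturbedSolution t t.2
  have hV : lyapunovV A = fun y => inner ℝ y (lyapunovOp A y) := funext hA.lyapunovV_eq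
  have hVc := continuous_inner_lyapunovOp_self A
  simp only [Real.toNNReal_coe] at h1 h2
  rw [hV, integrable_map_measure hVc.aestronglyMeasurable (hX.aemeasurable t),
    integral_map (hX.aemeasurable t) hVc.aestronglyMeasurable,
    abs_of_nonneg (integral_nonneg fun ω => hA.inner_lyapunovOp_self_nonneg _),
    ← Real.exp_mul, neg_mul]
  exact ⟨h1, h2⟩
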